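/- Let $(\mathbf X,\boldsymbol\gamma)=(I\times M^3,\,-N^2dt^2+g)$ be a globally hyperbolic spacetime written with respect to a time function: $I\subseteq\mathbb R$ is a nondegenerate interval (for instance $I=[0,T_{\max})$), $M^3$ is a smooth 3-manifold, $N=N(t,x)>0$ is smooth on $I\times M$, and $g=g_{ij}(t,x)\,dx^i dx^j$ is a smooth family of Riemannian metrics on $M$. (Apart from this product form, no causality condition is needed.) Let $T=N^{-1}\partial_t$ be the unit normal to the leaves $\{t\}\times M$, let $h_{ij}=-\frac1{2N}\partial_t g_{ij}$ be their second fundamental form and $H=g^{ij}h_{ij}$ their mean curvature. Let $\mathbf D$, $\mathbf R_{\alpha\beta\gamma\delta}$, $\mathbf R_{\alpha\beta}$, $\mathbf R$ be the Levi-Civita connection and the Riemann, Ricci and scalar curvature of $\boldsymbol\gamma$, with signs such that $\mathbf R_{\beta\delta}=\boldsymbol\gamma^{\alpha\gamma}\mathbf R_{\alpha\beta\gamma\delta}$ and round spheres have positive Ricci curvature. Let $$\mathbf W_{\alpha\beta\gamma\delta}=\mathbf R_{\alpha\beta\gamma\delta}-\tfrac12\left(\mathbf R_{\alpha\gamma}\boldsymbol\gamma_{\beta\delta}-\mathbf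 R_{\alpha\delta}\boldsymbol\gamma_{\beta\gamma}+\mathbf R_{\beta\delta}\boldsymbol\gamma_{\alpha\gamma}-\mathbf R_{\beta\gamma}\boldsymbol\gamma_{\alpha\delta}\right)+\tfrac{\mathbf R}{6}\left(\boldsymbol\gamma_{\alpha\gamma}\boldsymbol\gamma_{\beta\delta}-\boldsymbol\gamma_{\alpha\delta}\boldsymbol\gamma_{\beta\gamma}\right)$$ be the Weyl tensor, $|\mathbf W|^2$ its full contraction with itself by $\boldsymbol\gamma$, and $$\mathbf C_{\alpha\beta\gamma}=\mathbf D_\gamma\mathbf A_{\alpha\beta}-\mathbf D_\beta\mathbf A_{\alpha\gamma},\qquad \mathbf A_{\alpha\beta}=\mathbf R_{\alpha\beta}-\tfrac{\mathbf R}{6}\boldsymbol\gamma_{\alpha\beta},$$ the Cotton tensor. An index $T$ denotes evaluation on the vector $T$, and $i,j,k,l$ refer to arbitrary local coordinates $x^1,x^2,x^3$ on $M$. If the spacetime is purely electric, i.e. $\mathbf W_{Tijk}\equiv 0$ on $\mathbf X$, then everywhere on $\mathbf X$ $$\tfrac12\,\mathbf D_T|\mathbf W|^2=16\,H\,|\mathbf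 W_{TiTj}|^2-24\,h_{jl}\,\mathbf W_{TiTj}\,\mathbf W_{TiTl}-4\,\mathbf C_{ijT}\,\mathbf W_{TiTj},$$ where repeated space indices are contracted with $g^{ij}$ and $|\mathbf W_{TiTj}|^2=g^{ik}g^{jl}\mathbf W_{TiTj}\mathbf W_{TkTl}$. At an endpoint of $I$ belonging to $I$, derivatives in $t$ are one-sided. -/

import Mathlib

open scoped Manifold ContDiff

/-- The coordinate space of the spacetime coordinates `(t, x¹, x², x³)`. -/
abbrev Coord4 : Type := ℝ × EuclideanSpace ℝ (Fin 3)

namespace Coord4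

/-- The coordinate vectors `∂_0 = ∂_t` and `∂_1, ∂_2, ∂_3`. -/
noncomputable def basisVec (α : Fin 4) : Coord4 :=
  Fin.cases ((1 : ℝ), (0 : EuclideanSpace ℝ (Fin 3)))
    (fun i => ((0 : ℝ), EuclideanSpace.single i (1 : ℝ))) α

/-- The partial derivative `∂_α f` of a function on the coordinate domain `D`. It is taken within
`D`, so that it is one-sided in `t` at an endpoint of the time interval. -/
noncomputable def pd (D : Set Coord4) (α : Fin 4) (f : Coord4 → ℝ) (p : Coord4) : ℝ :=
  fderivWithin ℝ f D p (basisVec α)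

/-! In the following definitions `G p` is the matrix `γ_{αβ}(p)` of a metric on the coordinate
domain `D`, and `(G p)⁻¹` is the matrix `γ^{αβ}(p)`. -/

variable (D : Set Coord4) (G : Coord4 → Matrix (Fin 4) (Fin 4) ℝ)

/-- The Christoffel symbols `Γ^l_{αβ}` of the Levi-Civita connection. -/
noncomputable def christoffel (l α β : Fin 4) (p : Coord4) : ℝ :=
  (1 / 2) * ∑ m, (G p)⁻¹ l m *
    (pd D α (fun q => G q m β) p + pd D β (fun q => G q m α) p - pd D m (fun q => G q α β) p)

/-- The curvature tensor `R^l_{βγδ}`. -/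
noncomputable def riemannUp (l β c d : Fin 4) (p : Coord4) : ℝ :=
  pd D c (christoffel D G l d β) p - pd D d (christoffel D G l c β) p
    + ∑ m, (christoffel D G l c m p * christoffel D G m d β p
        - christoffel D G l d m p * christoffel D G m c β p)

/-- The curvature tensor `R_{αβγδ}`, with the sign for which `R_{ijij}` is positive on round
spheres. -/
noncomputable def riemann (α β c d : Fin 4) (p : Coord4) : ℝ :=
  ∑ l, G p α l * riemannUp D G l β c d p

/-- The Ricci tensor `R_{βδ} = γ^{αγ} R_{αβγδ}`. -/
noncomputable def ricci (β d : Fin 4) (p : Coord4) : ℝ :=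
  ∑ α, ∑ c, (G p)⁻¹ α c * riemann D G α β c d p

/-- The scalar curvature `R = γ^{αβ} R_{αβ}`. -/
noncomputable def scalar (p : Coord4) : ℝ :=
  ∑ α, ∑ β, (G p)⁻¹ α β * ricci D G α β p

/-- The Weyl tensor `W_{αβγδ}` of a metric in dimension four. -/
noncomputable def weyl (α β c d : Fin 4) (p : Coord4) : ℝ :=
  riemann D G α β c d p
    - (1 / 2) * (ricci D G α c p * G p β d - ricci D G α d p * G p β c
        + ricci D G β d p * G p α c - ricci D G β c p * G p α d)
    + scalar D G p / 6 * (G p α c * G p β d - G p α d * G p β c)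

/-- `|W|² = γ^{αα'} γ^{ββ'} γ^{γγ'} γ^{δδ'} W_{αβγδ} W_{α'β'γ'δ'}`. -/
noncomputable def weylNormSq (p : Coord4) : ℝ :=
  ∑ α, ∑ β, ∑ c, ∑ d, ∑ α', ∑ β', ∑ c', ∑ d',
    (G p)⁻¹ α α' * (G p)⁻¹ β β' * (G p)⁻¹ c c' * (G p)⁻¹ d d'
      * weyl D G α β c d p * weyl D G α' β' c' d' p

/-- The covariant derivative `D_γ P_{αβ}` of a `(0,2)`-tensor `P`. -/
noncomputable def covDeriv (P : Fin 4 → Fin 4 → Coord4 → ℝ) (c α β : Fin 4) (p : Coord4) : ℝ :=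
  pd D c (P α β) p
    - ∑ l, (christoffel D G l c α p * P l β p + christoffel D G l c β p * P α l p)

/-- The Schouten tensor `A_{αβ} = R_{αβ} - (R / 6) γ_{αβ}`. -/
noncomputable def schouten (α β : Fin 4) (p : Coord4) : ℝ :=
  ricci D G α β p - scalar D G p / 6 * G p α β

/-- The Cotton tensor `C_{αβγ} = D_γ A_{αβ} - D_β A_{αγ}`. -/
noncomputable def cotton (α β c : Fin 4) (p : Coord4) : ℝ :=
  covDeriv D G (schouten D G) c α β p - covDeriv D G (schouten D G) β α c p

end Coord4

/-- A spacetime `(X, γ) = (I × M, -N² dt² + g)`, where `I` is an interval (possibly containing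
endpoints), `M` is a smooth 3-manifold, the lapse `N` is a smooth positive function on `I × M`,
and `g = g(t)`, `t ∈ I`, is a smooth family of Riemannian metrics on `M`. The values of `N` and `g`
at times outside `I` are irrelevant. Globally hyperbolic spacetimes, foliated by the level sets of
a time function, have this form; no other causality condition is imposed. -/
structure FoliatedSpacetime (M : Type*) [TopologicalSpace M]
    [ChartedSpace (EuclideanSpace ℝ (Fin 3)) M] [IsManifold (𝓡 3) ∞ M] where
  /-- the time interval `I` -/
  interval : Set ℝ
  interval_ordConnected : interval.OrdConnected
  interval_nontrivial : interval.Nontrivial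
  /-- the lapse function `N` -/
  lapse : ℝ → M → ℝ
  lapse_pos : ∀ t ∈ interval, ∀ x, 0 < lapse t x
  lapse_smooth : ContMDiffOn (𝓘(ℝ, ℝ).prod (𝓡 3)) 𝓘(ℝ, ℝ) ∞
    (fun p : ℝ × M => lapse p.1 p.2) (interval ×ˢ Set.univ)
  /-- the metrics `g(t)` on the leaves -/
  metric : ℝ → (x : M) → (TangentSpace (𝓡 3) x →L[ℝ] TangentSpace (𝓡 3) x →L[ℝ] ℝ)
  metric_symm : ∀ t ∈ interval, ∀ x, ∀ v w : TangentSpace (𝓡 3) x,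
    metric t x v w = metric t x w v
  metric_pos : ∀ t ∈ interval, ∀ x, ∀ v : TangentSpace (𝓡 3) x, v ≠ 0 → 0 < metric t x v v
  metric_smooth : ContMDiffOn (𝓘(ℝ, ℝ).prod (𝓡 3))
    ((𝓡 3).prod 𝓘(ℝ, EuclideanSpace ℝ (Fin 3) →L[ℝ] EuclideanSpace ℝ (Fin 3) →L[ℝ] ℝ)) ∞
    (fun p : ℝ × M => Bundle.TotalSpace.mk'
      (EuclideanSpace ℝ (Fin 3) →L[ℝ] EuclideanSpace ℝ (Fin 3) →L[ℝ] ℝ)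
      (E := fun x : M => TangentSpace (𝓡 3) x →L[ℝ] TangentSpace (𝓡 3) x →L[ℝ] ℝ)
      p.2 (metric p.1 p.2)) (interval ×ˢ Set.univ)

namespace FoliatedSpacetime

variable {M : Type*} [TopologicalSpace M] [ChartedSpace (EuclideanSpace ℝ (Fin 3)) M]
  [IsManifold (𝓡 3) ∞ M] (X : FoliatedSpacetime M)
  (e : OpenPartialHomeomorph M (EuclideanSpace ℝ (Fin 3)))

/-! All components are taken with respect to the spacetime coordinates `(t, x¹, x², x³)` given by
a chart `e` of `M`. Spacetime indices run over `Fin 4`, with `0` the index of `t`; space indices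
run over `Fin 3`, the space index `i` being the spacetime index `i.succ`. -/

/-- The domain `I × e(U)` of the coordinates `(t, x¹, x², x³)`. -/
def domain : Set Coord4 := X.interval ×ˢ e.target

/-- The lapse `N` in coordinates. -/
noncomputable def N (p : Coord4) : ℝ := X.lapse p.1 (e.symm p.2)

/-- The coordinate vector field `∂_i` on `M` at the point with coordinates `y`. -/
noncomputable def coordVec (i : Fin 3) (y : EuclideanSpace ℝ (Fin 3)) :
    TangentSpace (𝓡 3) (e.symm y) :=
  mfderiv (𝓡 3) (𝓡 3) e.symm y (EuclideanSpace.single i (1 : ℝ) : EuclideanSpace ℝ (Fin 3))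

/-- The matrix `g_{ij} = g(∂_i, ∂_j)`; its inverse is the matrix `g^{ij}`. -/
noncomputable def g (p : Coord4) : Matrix (Fin 3) (Fin 3) ℝ :=
  Matrix.of fun i j => X.metric p.1 (e.symm p.2) (coordVec e i p.2) (coordVec e j p.2)

/-- The matrix `γ_{αβ}` of the spacetime metric `γ = -N² dt² + g_{ij} dxⁱ dxʲ`. -/
noncomputable def gam (p : Coord4) : Matrix (Fin 4) (Fin 4) ℝ :=
  Matrix.of fun α β =>
    Fin.cases (Fin.cases (-(X.N e p) ^ 2) (fun _ => 0) β)
      (fun i => Fin.cases 0 (fun j => X.g e p i j) β) α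

/-- The derivative `D_T f = N⁻¹ ∂_t f` of a function `f` along the unit normal `T = N⁻¹ ∂_t`. -/
noncomputable def normalDeriv (f : Coord4 → ℝ) (p : Coord4) : ℝ :=
  (X.N e p)⁻¹ * Coord4.pd (X.domain e) 0 f p

/-- The second fundamental form `h_{ij} = -(1 / (2N)) ∂_t g_{ij}` of the leaves. -/
noncomputable def h (p : Coord4) (i j : Fin 3) : ℝ :=
  -(1 / (2 * X.N e p)) * Coord4.pd (X.domain e) 0 (fun q => X.g e q i j) p

/-- The mean curvature `H = g^{ij} h_{ij}` of the leaves. -/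
noncomputable def meanCurv (p : Coord4) : ℝ :=
  ∑ i, ∑ j, (X.g e p)⁻¹ i j * X.h e p i j

/-- `|W|²` for the Weyl tensor `W` of the spacetime metric. -/
noncomputable def weylNormSq (p : Coord4) : ℝ :=
  Coord4.weylNormSq (X.domain e) (X.gam e) p

/-- `W_{Tijk} = W(T, ∂_i, ∂_j, ∂_k)`. -/
noncomputable def weylTijk (p : Coord4) (i j k : Fin 3) : ℝ :=
  (X.N e p)⁻¹ * Coord4.weyl (X.domain e) (X.gam e) 0 i.succ j.succ k.succ p

/-- `W_{TiTj} = W(T, ∂_i, T, ∂_j)`. -/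
noncomputable def weylTiTj (p : Coord4) (i j : Fin 3) : ℝ :=
  (X.N e p)⁻¹ * (X.N e p)⁻¹ * Coord4.weyl (X.domain e) (X.gam e) 0 i.succ 0 j.succ p

/-- `C_{ijT} = C(∂_i, ∂_j, T)`, where `C` is the Cotton tensor of the spacetime metric. -/
noncomputable def cottonijT (p : Coord4) (i j : Fin 3) : ℝ :=
  (X.N e p)⁻¹ * Coord4.cotton (X.domain e) (X.gam e) i.succ j.succ 0 p

/-- `|W_{TiTj}|² = g^{ii'} g^{jj'} W_{TiTj} W_{Ti'Tj'}`. -/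
noncomputable def electricNormSq (p : Coord4) : ℝ :=
  ∑ i, ∑ j, ∑ i', ∑ j', (X.g e p)⁻¹ i i' * (X.g e p)⁻¹ j j'
    * X.weylTiTj e p i j * X.weylTiTj e p i' j'

/-- `h_{jl} W_{TiTj} W_{TiTl}`, that is `g^{ii'} g^{jj'} g^{ll'} h_{jl} W_{TiTj'} W_{Ti'Tl'}`. -/
noncomputable def hWW (p : Coord4) : ℝ :=
  ∑ i, ∑ j, ∑ l, ∑ i', ∑ j', ∑ l',
    (X.g e p)⁻¹ i i' * (X.g e p)⁻¹ j j' * (X.g e p)⁻¹ l l'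
      * X.h e p j l * X.weylTiTj e p i j' * X.weylTiTj e p i' l'

/-- `C_{ijT} W_{TiTj}`, that is `g^{ii'} g^{jj'} C_{ijT} W_{Ti'Tj'}`. -/
noncomputable def CW (p : Coord4) : ℝ :=
  ∑ i, ∑ j, ∑ i', ∑ j', (X.g e p)⁻¹ i i' * (X.g e p)⁻¹ j j'
    * X.cottonijT e p i j * X.weylTiTj e p i' j'

/-- The spacetime is purely electric: `W_{Tijk} = 0` on the whole spacetime, in all local coordinates of `M`. -/
def PureElectric : Prop :=
  ∀ e ∈ IsManifold.maximalAtlas (𝓡 3) ∞ M, ∀ p ∈ X.domain e, ∀ i j k : Fin 3,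
    X.weylTijk e p i j k = 0

end FoliatedSpacetime

/-! The divergence equation of the Weyl tensor is an evolution equation for its electric part. Write
E for the matrix of W_{TiTj}, q for the inverse of g and C for the matrix of C_{ijT}. Contracting
the second Bianchi identity twice gives D^a W_{abcd} = C_{bdc} / 2 (`div₄_weyl`).

The trace condition on W says that E is the Ricci tensor of the spatial part W_{ijkl} and that E is
itself trace-free. In dimension three this determines the spatial part: it is the Kulkarni-Nomizu
product of g and E (`IsCurvatureLike.eq_kulkarniNomizu`, `spatialWeyl_eq`). If also W_{Tijk} = 0,
then E carries the whole Weyl tensor, and |W|² = 8 tr(qEqE) (`weylNormSq_eq`): one half comes from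
the four placements of two indices T, the other from the spatial part.

Now take b = i, c = t, d = j in the divergence. Since W_{Tijk} vanishes everywhere, its spatial
derivatives drop out; the spatial Christoffel symbols and the gradient of the lapse multiply only
vanishing components. What survives is ∂_t E and terms in h, whence ∂_t E = N (2HE + tr(qhqE) g - 3
hqE - 2 Eqh - C/2) (`pdMat_electric`).

Finally 8 tr(qEqE) is differentiated with ∂_t q = 2N qhq. Apart from the factor 8N, the two q's
contribute 4 tr(qhqEqE), the two E's contribute 4H tr(qEqE) - 10 tr(qhqEqE) - tr(qCqE), and the term
in g vanishes because E is trace-free. The factor 8/2 turns 4, 4 - 10, -1 into 16, -24, -4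
(`normalDeriv_weylNormSq`).

All of this is done in coordinates with connection matrices and curvature matrices, so that the
identities of Riemannian geometry become identities in a noncommutative ring. -/

namespace Coord4

/-! ### Partial derivatives up to the boundary of a coordinate domain. -/

section PartialDerivative

variable {D : Set Coord4} {f f' : Coord4 → ℝ} {p : Coord4}

lemma pd_congr (h : Set.EqOn f f' D) (hp : p ∈ D) (α : Fin 4) : pd D α f p = pd D α f' p := by
  unfold pd
  rw [fderivWithin_congr h (h hp)]

lemma pd_const (c : ℝ) (α : Fin 4) : pd D α (fun _ => c) p = 0 := by
  simp [pd]

lemma _root_.ContDiffOn.pd (hU : UniqueDiffOn ℝ D) (hf : ContDiffOn ℝ ∞ f D) (α : Fin 4) :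
    ContDiffOn ℝ ∞ (pd D α f) D :=
  (hf.fderivWithin hU (m := ∞) (by simp)).clm_apply contDiffOn_const

lemma _root_.ContDiffOn.differentiableWithinAt_of_mem (hf : ContDiffOn ℝ ∞ f D) (hp : p ∈ D) :
    DifferentiableWithinAt ℝ f D p :=
  hf.differentiableOn (by simp) p hp

lemma pd_add (hU : UniqueDiffOn ℝ D) (hf : ContDiffOn ℝ ∞ f D) (hf' : ContDiffOn ℝ ∞ f' D)
    (hp : p ∈ D) (α : Fin 4) : pd D α (fun q => f q + f' q) p = pd D α f p + pd D α f' p := by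
  unfold pd
  rw [fderivWithin_fun_add (hU p hp) (hf.differentiableWithinAt_of_mem hp)
    (hf'.differentiableWithinAt_of_mem hp)]
  rfl

lemma pd_sub (hU : UniqueDiffOn ℝ D) (hf : ContDiffOn ℝ ∞ f D) (hf' : ContDiffOn ℝ ∞ f' D)
    (hp : p ∈ D) (α : Fin 4) : pd D α (fun q => f q - f' q) p = pd D α f p - pd D α f' p := by
  unfold pd
  rw [fderivWithin_fun_sub (hU p hp) (hf.differentiableWithinAt_of_mem hp)
    (hf'.differentiableWithinAt_of_mem hp)]
  rfl

lemma pd_mul (hU : UniqueDiffOn ℝ D) (hf : ContDiffOn ℝ ∞ f D) (hf' : ContDiffOn ℝ ∞ f' D)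
    (hp : p ∈ D) (α : Fin 4) :
    pd D α (fun q => f q * f' q) p = pd D α f p * f' p + f p * pd D α f' p := by
  unfold pd
  rw [fderivWithin_fun_mul (hU p hp) (hf.differentiableWithinAt_of_mem hp)
    (hf'.differentiableWithinAt_of_mem hp)]
  simp
  ring

lemma pd_const_mul (hU : UniqueDiffOn ℝ D) (c : ℝ) (hf : ContDiffOn ℝ ∞ f D)
    (hp : p ∈ D) (α : Fin 4) : pd D α (fun q => c * f q) p = c * pd D α f p := by
  rw [pd_mul hU contDiffOn_const hf hp, pd_const]; ring

lemma pd_sum (hU : UniqueDiffOn ℝ D) {ι : Type*} (s : Finset ι) {F : ι → Coord4 → ℝ}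
    (hF : ∀ i ∈ s, ContDiffOn ℝ ∞ (F i) D) (hp : p ∈ D) (α : Fin 4) :
    pd D α (fun q => ∑ i ∈ s, F i q) p = ∑ i ∈ s, pd D α (F i) p := by
  unfold pd
  rw [fderivWithin_fun_sum (hU p hp) (fun i hi => (hF i hi).differentiableWithinAt_of_mem hp)]
  simp

/-- At a boundary point the symmetry of the second derivative is inherited from interior points;
this is the role of `D ⊆ closure (interior D)`. -/
lemma pd_comm (hU : UniqueDiffOn ℝ D) (hD : D ⊆ closure (interior D)) (hf : ContDiffOn ℝ ∞ f D)
    (hp : p ∈ D) (α β : Fin 4) : pd D α (pd D β f) p = pd D β (pd D α f) p := by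
  have key : ∀ α β, pd D α (pd D β f) p
      = fderivWithin ℝ (fderivWithin ℝ f D) D p (basisVec α) (basisVec β) := by
    intro α β
    have h1 : DifferentiableWithinAt ℝ (fderivWithin ℝ f D) D p :=
      (hf.fderivWithin hU (m := ∞) (by simp)).differentiableOn (by simp) p hp
    have := fderivWithin_clm_apply (hU p hp) h1
      (differentiableWithinAt_const (basisVec β))
    change fderivWithin ℝ (fun q => fderivWithin ℝ f D q (basisVec β)) D p (basisVec α) = _
    rw [this]
    simp
  rw [key, key]
  exact ((hf p hp).isSymmSndFDerivWithinAt
    (by simp only [minSmoothness_of_isRCLikeNormedField]; exact ENat.LEInfty.out) hU (hD hp) hp).eq _ _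

end PartialDerivative

/-! ### Entrywise calculus of matrix-valued functions. -/

section MatrixDerivative

variable {D : Set Coord4} {p : Coord4} {ι κ μ : Type*}

/-- The entrywise partial derivative of a matrix-valued function. -/
noncomputable def pdMat (D : Set Coord4) (α : Fin 4) (A : Coord4 → Matrix ι κ ℝ) (p : Coord4) :
    Matrix ι κ ℝ :=
  Matrix.of fun i j => pd D α (fun q => A q i j) p

/-- A matrix-valued function is smooth when its entries are. -/
def SmoothMat (D : Set Coord4) (A : Coord4 → Matrix ι κ ℝ) : Prop :=
  ∀ i j, ContDiffOn ℝ ∞ (fun q => A q i j) D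

lemma SmoothMat.pdMat {A : Coord4 → Matrix ι κ ℝ} (hU : UniqueDiffOn ℝ D) (hA : SmoothMat D A)
    (α : Fin 4) : SmoothMat D (pdMat D α A) :=
  fun i j => (hA i j).pd hU α

lemma SmoothMat.transpose {A : Coord4 → Matrix ι κ ℝ} (hA : SmoothMat D A) :
    SmoothMat D (fun q => (A q).transpose) :=
  fun i j => hA j i

lemma SmoothMat.add {A B : Coord4 → Matrix ι κ ℝ} (hA : SmoothMat D A) (hB : SmoothMat D B) :
    SmoothMat D (fun q => A q + B q) :=
  fun i j => (hA i j).add (hB i j)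

lemma SmoothMat.sub {A B : Coord4 → Matrix ι κ ℝ} (hA : SmoothMat D A) (hB : SmoothMat D B) :
    SmoothMat D (fun q => A q - B q) :=
  fun i j => (hA i j).sub (hB i j)

lemma SmoothMat.mul [Fintype κ] {A : Coord4 → Matrix ι κ ℝ} {B : Coord4 → Matrix κ μ ℝ}
    (hA : SmoothMat D A) (hB : SmoothMat D B) : SmoothMat D (fun q => A q * B q) := fun i j => by
  simp only [Matrix.mul_apply]
  exact ContDiffOn.sum fun k _ => (hA i k).mul (hB k j)

/-- Cramer's rule: an entry of the adjugate is the determinant of the matrix with one row made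
constant, so inverse entries are quotients of smooth determinants. -/
lemma SmoothMat.inv [Fintype ι] [DecidableEq ι] {A : Coord4 → Matrix ι ι ℝ} (hA : SmoothMat D A)
    (hdet : ∀ q ∈ D, IsUnit (A q).det) : SmoothMat D (fun q => (A q)⁻¹) := by
  have hd : ∀ {B : Coord4 → Matrix ι ι ℝ}, SmoothMat D B →
      ContDiffOn ℝ ∞ (fun q => (B q).det) D := by
    intro B hB
    simp only [Matrix.det_apply]
    refine ContDiffOn.sum fun σ _ => ContDiffOn.const_smul _ ?_
    exact contDiffOn_prod fun i _ => hB _ _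
  intro i j
  simp only [Matrix.inv_def, Matrix.smul_apply, Matrix.adjugate_apply, smul_eq_mul,
    Ring.inverse_eq_inv']
  refine ((hd hA).inv fun q hq => (hdet q hq).ne_zero).mul (hd fun k l => ?_)
  by_cases hk : k = j
  · subst hk
    simp only [Matrix.updateRow_self]
    exact contDiffOn_const
  · simp only [Matrix.updateRow_ne hk]
    exact hA k l

lemma pdMat_congr {A B : Coord4 → Matrix ι κ ℝ} (h : Set.EqOn A B D) (hp : p ∈ D) (α : Fin 4) :
    pdMat D α A p = pdMat D α B p := by
  ext i j
  exact pd_congr (fun q hq => by simp only [h hq]) hp α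

lemma pdMat_transpose (A : Coord4 → Matrix ι κ ℝ) (α : Fin 4) :
    pdMat D α (fun q => (A q).transpose) p = (pdMat D α A p).transpose := rfl

lemma pdMat_add {A B : Coord4 → Matrix ι κ ℝ} (hU : UniqueDiffOn ℝ D) (hA : SmoothMat D A)
    (hB : SmoothMat D B) (hp : p ∈ D) (α : Fin 4) :
    pdMat D α (fun q => A q + B q) p = pdMat D α A p + pdMat D α B p := by
  ext i j
  exact pd_add hU (hA i j) (hB i j) hp α

lemma pdMat_sub {A B : Coord4 → Matrix ι κ ℝ} (hU : UniqueDiffOn ℝ D) (hA : SmoothMat D A)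
    (hB : SmoothMat D B) (hp : p ∈ D) (α : Fin 4) :
    pdMat D α (fun q => A q - B q) p = pdMat D α A p - pdMat D α B p := by
  ext i j
  exact pd_sub hU (hA i j) (hB i j) hp α

lemma pdMat_mul [Fintype κ] {A : Coord4 → Matrix ι κ ℝ} {B : Coord4 → Matrix κ μ ℝ}
    (hU : UniqueDiffOn ℝ D) (hA : SmoothMat D A) (hB : SmoothMat D B) (hp : p ∈ D) (α : Fin 4) :
    pdMat D α (fun q => A q * B q) p = pdMat D α A p * B p + A p * pdMat D α B p := by
  ext i j
  simp only [pdMat, Matrix.of_apply, Matrix.mul_apply, Matrix.add_apply]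
  rw [pd_sum hU _ (fun k _ => (hA i k).mul (hB k j)) hp, ← Finset.sum_add_distrib]
  exact Finset.sum_congr rfl fun k _ => pd_mul hU (hA i k) (hB k j) hp α

lemma pdMat_comm {A : Coord4 → Matrix ι κ ℝ} (hU : UniqueDiffOn ℝ D)
    (hD : D ⊆ closure (interior D)) (hA : SmoothMat D A) (hp : p ∈ D) (α β : Fin 4) :
    pdMat D α (pdMat D β A) p = pdMat D β (pdMat D α A) p := by
  ext i j
  exact pd_comm hU hD (hA i j) hp α β

lemma pdMat_inv [Fintype ι] [DecidableEq ι] {A : Coord4 → Matrix ι ι ℝ} (hU : UniqueDiffOn ℝ D)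
    (hA : SmoothMat D A) (hdet : ∀ q ∈ D, IsUnit (A q).det) (hp : p ∈ D) (α : Fin 4) :
    pdMat D α (fun q => (A q)⁻¹) p = -((A p)⁻¹ * pdMat D α A p * (A p)⁻¹) := by
  have h1 : pdMat D α (fun q => (A q)⁻¹ * A q) p = 0 := by
    rw [pdMat_congr (B := fun _ => 1) (fun q hq => Matrix.nonsing_inv_mul _ (hdet q hq)) hp]
    ext i j
    exact pd_const _ _
  rw [pdMat_mul hU (hA.inv hdet) hA hp] at h1
  have h2 := congrArg (· * (A p)⁻¹) (eq_neg_of_add_eq_zero_left h1)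
  simpa [Matrix.mul_assoc, Matrix.mul_nonsing_inv _ (hdet p hp)] using h2

lemma pd_trace [Fintype ι] {A : Coord4 → Matrix ι ι ℝ} (hU : UniqueDiffOn ℝ D)
    (hA : SmoothMat D A) (hp : p ∈ D) (α : Fin 4) :
    pd D α (fun q => (A q).trace) p = (pdMat D α A p).trace := by
  simp only [Matrix.trace, Matrix.diag]
  exact pd_sum hU _ (fun i _ => hA i i) hp α

end MatrixDerivative

end Coord4

/-! ### The Levi-Civita connection and the symmetries of its curvature. -/

namespace Coord4

/-- A smooth semi-Riemannian metric on a coordinate domain. -/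
structure IsMetric (D : Set Coord4) (G : Coord4 → Matrix (Fin 4) (Fin 4) ℝ) : Prop where
  uniqueDiffOn : UniqueDiffOn ℝ D
  subset_closure : D ⊆ closure (interior D)
  smooth : SmoothMat D G
  symm : ∀ q ∈ D, (G q).IsSymm
  isUnit_det : ∀ q ∈ D, IsUnit (G q).det

/-- The connection matrix `(Γ_α)^l_β`. -/
noncomputable def connMat (D : Set Coord4) (G : Coord4 → Matrix (Fin 4) (Fin 4) ℝ) (α : Fin 4)
    (p : Coord4) : Matrix (Fin 4) (Fin 4) ℝ :=
  Matrix.of fun l β => christoffel D G l α β p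

/-- The curvature matrix `(R_{γδ})^l_β`. -/
noncomputable def curvMat (D : Set Coord4) (G : Coord4 → Matrix (Fin 4) (Fin 4) ℝ) (c d : Fin 4)
    (p : Coord4) : Matrix (Fin 4) (Fin 4) ℝ :=
  pdMat D c (connMat D G d) p - pdMat D d (connMat D G c) p
    + (connMat D G c p * connMat D G d p - connMat D G d p * connMat D G c p)

variable {D : Set Coord4} {G : Coord4 → Matrix (Fin 4) (Fin 4) ℝ} {p : Coord4}

lemma riemann_eq (a b c d : Fin 4) : riemann D G a b c d p = (G p * curvMat D G c d p) a b := by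
  simp only [riemann, riemannUp, Matrix.mul_apply, curvMat, Matrix.add_apply, Matrix.sub_apply,
    pdMat, connMat, Matrix.of_apply, Finset.sum_sub_distrib]

lemma curvMat_swap (c d : Fin 4) : curvMat D G c d p = -curvMat D G d c p := by
  simp only [curvMat, neg_add, neg_sub]

lemma riemann_swap_right (a b c d : Fin 4) : riemann D G a b c d p = -riemann D G a b d c p := by
  rw [riemann_eq, riemann_eq, curvMat_swap, mul_neg, Matrix.neg_apply]

namespace IsMetric

variable (hG : IsMetric D G)
include hG

lemma mul_inv (hp : p ∈ D) : G p * (G p)⁻¹ = 1 := Matrix.mul_nonsing_inv _ (hG.isUnit_det p hp)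

lemma inv_mul (hp : p ∈ D) : (G p)⁻¹ * G p = 1 := Matrix.nonsing_inv_mul _ (hG.isUnit_det p hp)

lemma symm_apply (hp : p ∈ D) (α β : Fin 4) : G p α β = G p β α := (hG.symm p hp).apply β α

lemma inv_symm_apply (hp : p ∈ D) (α β : Fin 4) : (G p)⁻¹ α β = (G p)⁻¹ β α :=
  (hG.symm p hp).inv.apply β α

lemma smooth_inv : SmoothMat D (fun q => (G q)⁻¹) := hG.smooth.inv hG.isUnit_det

lemma pd_symm (hp : p ∈ D) (c α β : Fin 4) :
    pd D c (fun q => G q α β) p = pd D c (fun q => G q β α) p :=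
  pd_congr (fun _ hq => hG.symm_apply hq α β) hp c

lemma christoffel_symm (hp : p ∈ D) (l α β : Fin 4) :
    christoffel D G l α β p = christoffel D G l β α p := by
  unfold christoffel
  congr 1
  refine Finset.sum_congr rfl fun m _ => ?_
  rw [hG.pd_symm hp m α β]
  ring

lemma smooth_christoffel (l α β : Fin 4) : ContDiffOn ℝ ∞ (christoffel D G l α β) D := by
  refine contDiffOn_const.mul (ContDiffOn.sum fun m _ => (hG.smooth_inv l m).mul ?_)
  exact (((hG.smooth _ _).pd hG.uniqueDiffOn _).add ((hG.smooth _ _).pd hG.uniqueDiffOn _)).sub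
    ((hG.smooth _ _).pd hG.uniqueDiffOn _)

lemma smooth_connMat (α : Fin 4) : SmoothMat D (connMat D G α) :=
  fun l β => hG.smooth_christoffel l α β

lemma smooth_curvMat (c d : Fin 4) : SmoothMat D (curvMat D G c d) :=
  (((hG.smooth_connMat d).pdMat hG.uniqueDiffOn c).sub
    ((hG.smooth_connMat c).pdMat hG.uniqueDiffOn d)).add
    (((hG.smooth_connMat c).mul (hG.smooth_connMat d)).sub
      ((hG.smooth_connMat d).mul (hG.smooth_connMat c)))

/-- Lowering the upper index removes the inverse metric and leaves the Christoffel symbols of the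
first kind. -/
lemma mul_connMat (hp : p ∈ D) (c a b : Fin 4) :
    (G p * connMat D G c p) a b = (1 / 2) * (pd D c (fun q => G q a b) p
      + pd D b (fun q => G q a c) p - pd D a (fun q => G q c b) p) := by
  let v : Fin 4 → ℝ := fun m => (1 / 2) * (pd D c (fun q => G q m b) p
    + pd D b (fun q => G q m c) p - pd D m (fun q => G q c b) p)
  have h1 : (G p * connMat D G c p) a b = (G p).mulVec ((G p)⁻¹.mulVec v) a := by
    simp only [Matrix.mul_apply, connMat, christoffel, Matrix.of_apply, Matrix.mulVec, dotProduct, v]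
    refine Finset.sum_congr rfl fun l _ => ?_
    rw [Finset.mul_sum]
    congr 1
    exact Finset.sum_congr rfl fun m _ => by ring
  rw [h1, Matrix.mulVec_mulVec, hG.mul_inv hp, Matrix.one_mulVec]

/-- Metric compatibility, Dγ = 0: when the symbols of the first kind for (a, b) and (b, a) are
added, four of the six derivatives cancel. -/
lemma pdMat_metric (hp : p ∈ D) (c : Fin 4) :
    pdMat D c G p = (connMat D G c p).transpose * G p + G p * connMat D G c p := by
  ext a b
  have h1 : ((connMat D G c p).transpose * G p) a b = (G p * connMat D G c p) b a := by
    rw [← Matrix.transpose_apply (G p * _), Matrix.transpose_mul, (hG.symm p hp).eq]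
  rw [Matrix.add_apply, h1, hG.mul_connMat hp, hG.mul_connMat hp, hG.pd_symm hp c b a,
    hG.pd_symm hp b c a, hG.pd_symm hp a c b]
  simp only [pdMat, Matrix.of_apply]
  ring

lemma pdMat_inv_metric (hp : p ∈ D) (c : Fin 4) :
    pdMat D c (fun q => (G q)⁻¹) p
      = -(connMat D G c p * (G p)⁻¹ + (G p)⁻¹ * (connMat D G c p).transpose) := by
  rw [pdMat_inv hG.uniqueDiffOn hG.smooth hG.isUnit_det hp, hG.pdMat_metric hp, mul_add, add_mul,
    ← mul_assoc, ← mul_assoc, hG.inv_mul hp, mul_assoc, mul_assoc, mul_assoc, hG.mul_inv hp,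
    one_mul, mul_one, add_comm]

/-- With Γ the connection and F the curvature matrices, substituting ∂G = ΓᵀG + GΓ into ∂_c ∂_d G -
∂_d ∂_c G = 0 leaves FᵀG + GF = 0. This is the skew symmetry of R in its first two indices. -/
lemma transpose_curvMat_mul (hp : p ∈ D) (c d : Fin 4) :
    (curvMat D G c d p).transpose * G p = -(G p * curvMat D G c d p) := by
  have hU := hG.uniqueDiffOn
  have key : ∀ c d, pdMat D c (pdMat D d G) p
      = (pdMat D c (connMat D G d) p).transpose * G p
        + (connMat D G d p).transpose
          * ((connMat D G c p).transpose * G p + G p * connMat D G c p)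
        + (((connMat D G c p).transpose * G p + G p * connMat D G c p) * connMat D G d p
        + G p * pdMat D c (connMat D G d) p) := by
    intro c d
    have hd := hG.smooth_connMat d
    rw [pdMat_congr (fun q hq => hG.pdMat_metric hq d) hp,
      pdMat_add hU (hd.transpose.mul hG.smooth) (hG.smooth.mul hd) hp,
      pdMat_mul hU hd.transpose hG.smooth hp, pdMat_mul hU hG.smooth hd hp, hG.pdMat_metric hp,
      pdMat_transpose]
  have h := pdMat_comm hU hG.subset_closure hG.smooth hp c d
  rw [key, key] at h
  simp only [curvMat, Matrix.transpose_add, Matrix.transpose_sub, Matrix.transpose_mul]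
  rw [eq_neg_iff_add_eq_zero, ← sub_eq_zero.2 h]
  noncomm_ring

/-- The identity dF + [Γ, F] = 0 for F = dΓ + Γ ∧ Γ: second derivatives of Γ cancel because they
commute, the remaining terms by noncommutative algebra. -/
lemma second_bianchi_curvMat (hp : p ∈ D) (e c d : Fin 4) :
    (pdMat D e (curvMat D G c d) p + connMat D G e p * curvMat D G c d p
        - curvMat D G c d p * connMat D G e p)
      + (pdMat D c (curvMat D G d e) p + connMat D G c p * curvMat D G d e p
        - curvMat D G d e p * connMat D G c p)
      + (pdMat D d (curvMat D G e c) p + connMat D G d p * curvMat D G e c p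
        - curvMat D G e c p * connMat D G d p) = 0 := by
  have hU := hG.uniqueDiffOn
  have key : ∀ e c d, pdMat D e (curvMat D G c d) p
      = pdMat D e (pdMat D c (connMat D G d)) p - pdMat D e (pdMat D d (connMat D G c)) p
        + (pdMat D e (connMat D G c) p * connMat D G d p
          + connMat D G c p * pdMat D e (connMat D G d) p
          - (pdMat D e (connMat D G d) p * connMat D G c p
          + connMat D G d p * pdMat D e (connMat D G c) p)) := by
    intro e c d
    have hc := hG.smooth_connMat c
    have hd := hG.smooth_connMat d
    change pdMat D e (fun q => pdMat D c (connMat D G d) q - pdMat D d (connMat D G c) q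
      + (connMat D G c q * connMat D G d q - connMat D G d q * connMat D G c q)) p = _
    rw [pdMat_add hU ((hd.pdMat hU c).sub (hc.pdMat hU d)) ((hc.mul hd).sub (hd.mul hc)) hp,
      pdMat_sub hU (hd.pdMat hU c) (hc.pdMat hU d) hp,
      pdMat_sub hU (hc.mul hd) (hd.mul hc) hp, pdMat_mul hU hc hd hp, pdMat_mul hU hd hc hp]
  rw [key, key, key]
  have hcomm := fun a b m => pdMat_comm hU hG.subset_closure (hG.smooth_connMat m) hp a b
  rw [hcomm e c d, hcomm e d c, hcomm c d e]
  simp only [curvMat]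
  noncomm_ring

lemma smooth_riemann (a b c d : Fin 4) : ContDiffOn ℝ ∞ (riemann D G a b c d) D :=
  (((hG.smooth.mul (hG.smooth_curvMat c d)) a b)).congr fun _ _ => riemann_eq a b c d

lemma riemann_swap_left (hp : p ∈ D) (a b c d : Fin 4) :
    riemann D G a b c d p = -riemann D G b a c d p := by
  rw [riemann_eq, riemann_eq, ← Matrix.neg_apply, ← hG.transpose_curvMat_mul hp,
    ← Matrix.transpose_apply (G p * _), Matrix.transpose_mul, (hG.symm p hp).eq]

/-- A consequence of vanishing torsion: with symmetric Christoffel symbols, the cyclic sum cancels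
for each fixed upper index, and in the quadratic part for each summation index. -/
lemma first_bianchi (hp : p ∈ D) (a b c d : Fin 4) :
    riemann D G a b c d p + riemann D G a c d b p + riemann D G a d b c p = 0 := by
  simp only [riemann, ← Finset.sum_add_distrib, ← mul_add]
  refine Finset.sum_eq_zero fun l _ => ?_
  have hs : ∀ e α β, pd D e (christoffel D G l α β) p = pd D e (christoffel D G l β α) p :=
    fun e α β => pd_congr (fun _ hq => hG.christoffel_symm hq l α β) hp e
  simp only [riemannUp]
  rw [hs c d b, hs d c b, hs b d c]
  rw [mul_eq_zero]
  right
  suffices h : (∑ m, (christoffel D G l c m p * christoffel D G m d b p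
        - christoffel D G l d m p * christoffel D G m c b p))
      + (∑ m, (christoffel D G l d m p * christoffel D G m b c p
        - christoffel D G l b m p * christoffel D G m d c p))
      + (∑ m, (christoffel D G l b m p * christoffel D G m c d p
        - christoffel D G l c m p * christoffel D G m b d p)) = 0 by linarith
  rw [← Finset.sum_add_distrib, ← Finset.sum_add_distrib]
  refine Finset.sum_eq_zero fun m _ => ?_
  rw [hG.christoffel_symm hp m d b, hG.christoffel_symm hp m c b, hG.christoffel_symm hp m d c]
  ring

/-- The classical octahedron argument: four first Bianchi identities, one for each choice of first
index, combined with the two skew symmetries. -/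
lemma riemann_pair_symm (hp : p ∈ D) (a b c d : Fin 4) :
    riemann D G a b c d p = riemann D G c d a b p := by
  have h1 := hG.first_bianchi hp a b c d
  have h2 := hG.first_bianchi hp b c d a
  have h3 := hG.first_bianchi hp c d a b
  have h4 := hG.first_bianchi hp d a b c
  have s := fun a b c d => hG.riemann_swap_left hp a b c d
  have r := fun a b c d => riemann_swap_right (D := D) (G := G) (p := p) a b c d
  linarith [r a b c d, s b c d a, r c b d a, s b d a c, r d b a c, s b a c d, r c d b a, s c a b d,
    r a c b d, s d a b c, s d b c a, s d c a b, r c d a b, r b a d c, r a d b c, s a d b c,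
    r b d c a, r a c d b, r b c a d, r b d a c, r d b c a, s c b a d, s d a c b, s a b c d]

end IsMetric

end Coord4

/-! ### Covariant derivatives, contracted Bianchi identities and the divergence of the Weyl tensor.
-/

namespace Coord4

/-- The covariant derivative `D_e P_{abcd}` of a `(0,4)`-tensor `P`. -/
noncomputable def covDeriv₄ (D : Set Coord4) (G : Coord4 → Matrix (Fin 4) (Fin 4) ℝ)
    (P : Fin 4 → Fin 4 → Fin 4 → Fin 4 → Coord4 → ℝ) (e a b c d : Fin 4) (p : Coord4) : ℝ :=
  pd D e (P a b c d) p
    - ∑ l, (christoffel D G l e a p * P l b c d p + christoffel D G l e b p * P a l c d p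
      + christoffel D G l e c p * P a b l d p + christoffel D G l e d p * P a b c l p)

/-- The divergence `D^a P_{abcd}` of a `(0,4)`-tensor `P`. -/
noncomputable def div₄ (D : Set Coord4) (G : Coord4 → Matrix (Fin 4) (Fin 4) ℝ)
    (P : Fin 4 → Fin 4 → Fin 4 → Fin 4 → Coord4 → ℝ) (b c d : Fin 4) (p : Coord4) : ℝ :=
  ∑ a, ∑ e, (G p)⁻¹ a e * covDeriv₄ D G P e a b c d p

variable {D : Set Coord4} {G : Coord4 → Matrix (Fin 4) (Fin 4) ℝ} {p : Coord4}

lemma sum_comm₃ {ι κ μ : Type*} [Fintype ι] [Fintype κ] [Fintype μ] (F : ι → κ → μ → ℝ) :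
    ∑ i, ∑ j, ∑ k, F i j k = ∑ j, ∑ k, ∑ i, F i j k := by
  rw [Finset.sum_comm]
  exact Finset.sum_congr rfl fun j _ => Finset.sum_comm

lemma sum_comm₄ {ι κ μ ν : Type*} [Fintype ι] [Fintype κ] [Fintype μ] [Fintype ν]
    (F : ι → κ → μ → ν → ℝ) :
    ∑ i, ∑ j, ∑ k, ∑ l, F i j k l = ∑ k, ∑ l, ∑ i, ∑ j, F i j k l := by
  rw [← sum_comm₃ fun i k l => ∑ j, F i j k l]
  exact Finset.sum_congr rfl fun i _ => sum_comm₃ _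

lemma covDeriv₄_swap_left (P : Fin 4 → Fin 4 → Fin 4 → Fin 4 → Coord4 → ℝ) (e a b c d : Fin 4) :
    covDeriv₄ D G (fun a b c d => P b a c d) e a b c d p = covDeriv₄ D G P e b a c d p := by
  unfold covDeriv₄
  congr 1
  exact Finset.sum_congr rfl fun l _ => by ring

lemma covDeriv₄_swap_right (P : Fin 4 → Fin 4 → Fin 4 → Fin 4 → Coord4 → ℝ) (e a b c d : Fin 4) :
    covDeriv₄ D G (fun a b c d => P a b d c) e a b c d p = covDeriv₄ D G P e a b d c p := by
  unfold covDeriv₄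
  congr 1
  exact Finset.sum_congr rfl fun l _ => by ring

lemma covDeriv₄_congr {P Q : Fin 4 → Fin 4 → Fin 4 → Fin 4 → Coord4 → ℝ}
    (h : ∀ q ∈ D, ∀ a b c d, P a b c d q = Q a b c d q) (hp : p ∈ D) (e a b c d : Fin 4) :
    covDeriv₄ D G P e a b c d p = covDeriv₄ D G Q e a b c d p := by
  unfold covDeriv₄
  rw [pd_congr (fun q hq => h q hq a b c d) hp]
  simp only [h p hp]

lemma weyl_eq (a b c d : Fin 4) (p : Coord4) : weyl D G a b c d p = riemann D G a b c d p
    - (1 / 2) * (schouten D G a c p * G p b d - schouten D G a d p * G p b c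
        + (schouten D G b d p * G p a c - schouten D G b c p * G p a d)) := by
  simp only [weyl, schouten]
  ring

lemma weyl_swap_right (a b c d : Fin 4) : weyl D G a b c d p = -weyl D G a b d c p := by
  rw [weyl_eq, weyl_eq, riemann_swap_right]
  ring

namespace IsMetric

variable (hG : IsMetric D G)
include hG

lemma covDeriv₄_add {P Q : Fin 4 → Fin 4 → Fin 4 → Fin 4 → Coord4 → ℝ}
    (hP : ∀ a b c d, ContDiffOn ℝ ∞ (P a b c d) D) (hQ : ∀ a b c d, ContDiffOn ℝ ∞ (Q a b c d) D)
    (hp : p ∈ D) (e a b c d : Fin 4) :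
    covDeriv₄ D G (fun a b c d q => P a b c d q + Q a b c d q) e a b c d p
      = covDeriv₄ D G P e a b c d p + covDeriv₄ D G Q e a b c d p := by
  unfold covDeriv₄
  rw [pd_add hG.uniqueDiffOn (hP _ _ _ _) (hQ _ _ _ _) hp, sub_add_sub_comm,
    ← Finset.sum_add_distrib]
  congr 1
  exact Finset.sum_congr rfl fun l _ => by ring

lemma covDeriv₄_sub {P Q : Fin 4 → Fin 4 → Fin 4 → Fin 4 → Coord4 → ℝ}
    (hP : ∀ a b c d, ContDiffOn ℝ ∞ (P a b c d) D) (hQ : ∀ a b c d, ContDiffOn ℝ ∞ (Q a b c d) D)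
    (hp : p ∈ D) (e a b c d : Fin 4) :
    covDeriv₄ D G (fun a b c d q => P a b c d q - Q a b c d q) e a b c d p
      = covDeriv₄ D G P e a b c d p - covDeriv₄ D G Q e a b c d p := by
  unfold covDeriv₄
  rw [pd_sub hG.uniqueDiffOn (hP _ _ _ _) (hQ _ _ _ _) hp, sub_sub_sub_comm,
    ← Finset.sum_sub_distrib]
  congr 1
  exact Finset.sum_congr rfl fun l _ => by ring

lemma covDeriv₄_const_mul (r : ℝ) {P : Fin 4 → Fin 4 → Fin 4 → Fin 4 → Coord4 → ℝ}
    (hP : ∀ a b c d, ContDiffOn ℝ ∞ (P a b c d) D) (hp : p ∈ D) (e a b c d : Fin 4) :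
    covDeriv₄ D G (fun a b c d q => r * P a b c d q) e a b c d p
      = r * covDeriv₄ D G P e a b c d p := by
  unfold covDeriv₄
  rw [pd_const_mul hG.uniqueDiffOn r (hP _ _ _ _) hp, mul_sub, Finset.mul_sum]
  congr 1
  exact Finset.sum_congr rfl fun l _ => by ring

lemma pd_metric (hp : p ∈ D) (e a b : Fin 4) : pd D e (fun q => G q a b) p
    = ∑ l, (christoffel D G l e a p * G p l b + christoffel D G l e b p * G p a l) := by
  have h := congrFun (congrFun (hG.pdMat_metric hp e) a) b
  simp only [pdMat, connMat, Matrix.of_apply, Matrix.add_apply, Matrix.mul_apply,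
    Matrix.transpose_apply, ← Finset.sum_add_distrib] at h
  rw [h]
  exact Finset.sum_congr rfl fun l _ => by ring

/-- The product rule with Dγ = 0. The four Schouten-metric terms of the Weyl tensor are index
permutations of this product. -/
lemma covDeriv₄_mul_metric {S : Fin 4 → Fin 4 → Coord4 → ℝ} (hS : ∀ a b, ContDiffOn ℝ ∞ (S a b) D)
    (hp : p ∈ D) (e a b c d : Fin 4) :
    covDeriv₄ D G (fun a b c d q => S a c q * G q b d) e a b c d p
      = covDeriv D G S e a c p * G p b d := by
  unfold covDeriv₄ covDeriv
  rw [pd_mul hG.uniqueDiffOn (hS _ _) (hG.smooth _ _) hp, hG.pd_metric hp, sub_mul,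
    Finset.mul_sum, Finset.sum_mul, add_sub_assoc, ← Finset.sum_sub_distrib, sub_eq_add_neg,
    ← Finset.sum_neg_distrib]
  congr 1
  exact Finset.sum_congr rfl fun l _ => by ring

/-- Contraction with the parallel tensor γ^{ab} commutes with D, which on scalars is ∂. -/
lemma pd_contract {S : Fin 4 → Fin 4 → Coord4 → ℝ} (hS : ∀ a b, ContDiffOn ℝ ∞ (S a b) D)
    (hp : p ∈ D) (e : Fin 4) :
    pd D e (fun q => ∑ a, ∑ b, (G q)⁻¹ a b * S a b q) p
      = ∑ a, ∑ b, (G p)⁻¹ a b * covDeriv D G S e a b p := by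
  -- Transposed, so that the contraction is the trace of a matrix product.
  let A : Coord4 → Matrix (Fin 4) (Fin 4) ℝ := fun q => Matrix.of fun a b => S b a q
  have hA : SmoothMat D A := fun a b => hS b a
  have h1 : ∀ (P : Matrix (Fin 4) (Fin 4) ℝ) (Q : Matrix (Fin 4) (Fin 4) ℝ),
      ∑ a, ∑ b, P a b * Q b a = (P * Q).trace := fun P Q => by
    simp [Matrix.trace, Matrix.mul_apply]
  have h2 : ∑ a, ∑ b, (G p)⁻¹ a b * covDeriv D G S e a b p
      = ((G p)⁻¹ * (pdMat D e A p - A p * connMat D G e p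
        - (connMat D G e p).transpose * A p)).trace := by
    rw [← h1]
    refine Finset.sum_congr rfl fun a _ => Finset.sum_congr rfl fun b _ => ?_
    congr 1
    simp only [covDeriv, pdMat, connMat, Matrix.sub_apply, Matrix.mul_apply, Matrix.of_apply,
      Matrix.transpose_apply, A, sub_sub, ← Finset.sum_add_distrib]
    congr 1
    exact Finset.sum_congr rfl fun l _ => by ring
  have h3 : ∀ q, ∑ a, ∑ b, (G q)⁻¹ a b * S a b q = ((G q)⁻¹ * A q).trace := fun q => h1 _ (A q)
  simp only [h3]
  rw [h2, pd_trace hG.uniqueDiffOn (hG.smooth_inv.mul hA) hp,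
    pdMat_mul hG.uniqueDiffOn hG.smooth_inv hA hp, hG.pdMat_inv_metric hp]
  simp only [neg_mul, add_mul, mul_sub, Matrix.trace_add, Matrix.trace_sub, Matrix.trace_neg]
  rw [Matrix.mul_assoc (connMat D G e p), Matrix.trace_mul_comm (connMat D G e p)]
  simp only [Matrix.mul_assoc]
  ring

lemma covDeriv_contract {P : Fin 4 → Fin 4 → Fin 4 → Fin 4 → Coord4 → ℝ}
    (hP : ∀ a b c d, ContDiffOn ℝ ∞ (P a b c d) D) (hp : p ∈ D) (e b d : Fin 4) :
    covDeriv D G (fun b d q => ∑ a, ∑ c, (G q)⁻¹ a c * P a b c d q) e b d p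
      = ∑ a, ∑ c, (G p)⁻¹ a c * covDeriv₄ D G P e a b c d p := by
  rw [covDeriv, hG.pd_contract (S := fun a c => P a b c d) (fun a c => hP a b c d) hp]
  simp only [Finset.mul_sum, ← Finset.sum_add_distrib]
  rw [sum_comm₃, ← Finset.sum_sub_distrib]
  refine Finset.sum_congr rfl fun a _ => ?_
  rw [← Finset.sum_sub_distrib]
  refine Finset.sum_congr rfl fun c _ => ?_
  simp only [covDeriv, covDeriv₄, mul_sub, Finset.mul_sum, sub_sub, ← Finset.sum_add_distrib]
  congr 1
  exact Finset.sum_congr rfl fun l _ => by ring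

lemma smooth_ricci (b d : Fin 4) : ContDiffOn ℝ ∞ (ricci D G b d) D :=
  ContDiffOn.sum fun a _ => ContDiffOn.sum fun c _ =>
    (hG.smooth_inv a c).mul (hG.smooth_riemann a b c d)

lemma smooth_scalar : ContDiffOn ℝ ∞ (scalar D G) D :=
  ContDiffOn.sum fun a _ => ContDiffOn.sum fun b _ => (hG.smooth_inv a b).mul (hG.smooth_ricci a b)

lemma smooth_schouten (a b : Fin 4) : ContDiffOn ℝ ∞ (schouten D G a b) D :=
  (hG.smooth_ricci a b).sub ((hG.smooth_scalar.div_const 6).mul (hG.smooth a b))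

lemma smooth_weyl (a b c d : Fin 4) : ContDiffOn ℝ ∞ (weyl D G a b c d) D := by
  have hS := hG.smooth_schouten
  refine ContDiffOn.congr ?_ fun q _ => weyl_eq a b c d q
  exact (hG.smooth_riemann a b c d).sub (contDiffOn_const.mul
    ((((hS a c).mul (hG.smooth b d)).sub ((hS a d).mul (hG.smooth b c))).add
      (((hS b d).mul (hG.smooth a c)).sub ((hS b c).mul (hG.smooth a d)))))

/-- Metric compatibility takes G out of the derivative and turns the connection terms for a and b
into a commutator, as in `second_bianchi_curvMat`. The terms for c and d stay apart; they cancel in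
the cyclic sum by vanishing torsion. -/
lemma covDeriv₄_riemann (hp : p ∈ D) (e a b c d : Fin 4) :
    covDeriv₄ D G (riemann D G) e a b c d p
      = (G p * (pdMat D e (curvMat D G c d) p + connMat D G e p * curvMat D G c d p
          - curvMat D G c d p * connMat D G e p)) a b
        - ∑ l, (christoffel D G l e c p * riemann D G a b l d p
          + christoffel D G l e d p * riemann D G a b c l p) := by
  have h1 : pd D e (riemann D G a b c d) p = pdMat D e (fun q => G q * curvMat D G c d q) p a b :=
    pd_congr (fun _ _ => riemann_eq a b c d) hp e
  have h2 : (G p * (pdMat D e (curvMat D G c d) p + connMat D G e p * curvMat D G c d p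
          - curvMat D G c d p * connMat D G e p))
      = pdMat D e (fun q => G q * curvMat D G c d q) p
        - (connMat D G e p).transpose * (G p * curvMat D G c d p)
        - (G p * curvMat D G c d p) * connMat D G e p := by
    rw [pdMat_mul hG.uniqueDiffOn hG.smooth (hG.smooth_curvMat c d) hp, hG.pdMat_metric hp]
    noncomm_ring
  rw [h2, covDeriv₄, h1]
  simp only [Matrix.sub_apply]
  rw [Matrix.mul_apply, Matrix.mul_apply (M := G p * curvMat D G c d p)]
  simp only [sub_sub, ← Finset.sum_add_distrib]
  congr 1
  refine Finset.sum_congr rfl fun l _ => ?_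
  simp only [riemann_eq, connMat, Matrix.of_apply, Matrix.transpose_apply]
  ring

lemma second_bianchi (hp : p ∈ D) (e a b c d : Fin 4) :
    covDeriv₄ D G (riemann D G) e a b c d p + covDeriv₄ D G (riemann D G) c a b d e p
      + covDeriv₄ D G (riemann D G) d a b e c p = 0 := by
  have h := congrArg (fun A => (G p * A) a b) (hG.second_bianchi_curvMat hp e c d)
  simp only [mul_add, Matrix.add_apply, mul_zero, Matrix.zero_apply] at h
  have hz : (∑ l, (christoffel D G l e c p * riemann D G a b l d p
          + christoffel D G l e d p * riemann D G a b c l p))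
      + (∑ l, (christoffel D G l c d p * riemann D G a b l e p
          + christoffel D G l c e p * riemann D G a b d l p))
      + (∑ l, (christoffel D G l d e p * riemann D G a b l c p
          + christoffel D G l d c p * riemann D G a b e l p)) = 0 := by
    rw [← Finset.sum_add_distrib, ← Finset.sum_add_distrib]
    refine Finset.sum_eq_zero fun l _ => ?_
    rw [hG.christoffel_symm hp l c e, hG.christoffel_symm hp l d e, hG.christoffel_symm hp l d c,
      riemann_swap_right a b d l, riemann_swap_right a b c l, riemann_swap_right a b e l]
    ring
  rw [hG.covDeriv₄_riemann hp, hG.covDeriv₄_riemann hp, hG.covDeriv₄_riemann hp]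
  linarith

lemma covDeriv₄_riemann_swap_right (hp : p ∈ D) (e a b c d : Fin 4) :
    covDeriv₄ D G (riemann D G) e a b c d p = -covDeriv₄ D G (riemann D G) e a b d c p := by
  calc _ = covDeriv₄ D G (fun a b c d q => -1 * riemann D G a b d c q) e a b c d p :=
        covDeriv₄_congr (fun q _ a b c d => by rw [riemann_swap_right]; ring) hp _ _ _ _ _
    _ = -1 * covDeriv₄ D G (fun a b c d => riemann D G a b d c) e a b c d p :=
        hG.covDeriv₄_const_mul (-1) (fun a b c d => hG.smooth_riemann a b d c) hp e a b c d
    _ = _ := by rw [covDeriv₄_swap_right (riemann D G), neg_one_mul]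

lemma covDeriv₄_riemann_swap_both (hp : p ∈ D) (e a b c d : Fin 4) :
    covDeriv₄ D G (riemann D G) e a b c d p = covDeriv₄ D G (riemann D G) e b a d c p := by
  rw [← covDeriv₄_swap_right (riemann D G) e b a c d,
    ← covDeriv₄_swap_left (fun a b c d => riemann D G a b d c) e a b c d]
  exact covDeriv₄_congr (fun q hq a b c d => by
    rw [riemann_swap_right, hG.riemann_swap_left hq, neg_neg]) hp _ _ _ _ _

lemma covDeriv_ricci (hp : p ∈ D) (e b d : Fin 4) : covDeriv D G (ricci D G) e b d p
    = ∑ a, ∑ c, (G p)⁻¹ a c * covDeriv₄ D G (riemann D G) e a b c d p :=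
  hG.covDeriv_contract hG.smooth_riemann hp e b d

/-- The second Bianchi identity contracted once. -/
lemma div₄_riemann (hp : p ∈ D) (b c d : Fin 4) : div₄ D G (riemann D G) b c d p
    = covDeriv D G (ricci D G) c b d p - covDeriv D G (ricci D G) d b c p := by
  rw [hG.covDeriv_ricci hp, hG.covDeriv_ricci hp, div₄]
  simp only [← Finset.sum_sub_distrib, ← mul_sub]
  refine Finset.sum_congr rfl fun a _ => Finset.sum_congr rfl fun e _ => ?_
  congr 1
  linarith [hG.second_bianchi hp e a b c d, hG.covDeriv₄_riemann_swap_right hp c a b d e]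

/-- The trace of `div₄_riemann` over b and d. Swapping both index pairs identifies its left side
with the divergence of Ricci, which therefore occurs twice; hence the 1/2. -/
lemma contracted_bianchi (hp : p ∈ D) (c : Fin 4) :
    ∑ a, ∑ e, (G p)⁻¹ a e * covDeriv D G (ricci D G) e a c p = (1 / 2) * pd D c (scalar D G) p := by
  have h1 : pd D c (scalar D G) p = ∑ b, ∑ d, (G p)⁻¹ b d * covDeriv D G (ricci D G) c b d p :=
    hG.pd_contract hG.smooth_ricci hp c
  have h2 : ∑ b, ∑ d, (G p)⁻¹ b d * div₄ D G (riemann D G) b c d p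
      = ∑ a, ∑ e, (G p)⁻¹ a e * covDeriv D G (ricci D G) e a c p := by
    simp only [div₄, hG.covDeriv_ricci hp, Finset.mul_sum]
    rw [sum_comm₄]
    refine Finset.sum_congr rfl fun a _ => Finset.sum_congr rfl fun e _ =>
      Finset.sum_congr rfl fun b _ => Finset.sum_congr rfl fun d _ => ?_
    rw [hG.covDeriv₄_riemann_swap_both hp e a b c d]
    ring
  simp only [hG.div₄_riemann hp, mul_sub, Finset.sum_sub_distrib, ← h1] at h2
  linarith

lemma covDeriv_schouten (hp : p ∈ D) (e a b : Fin 4) : covDeriv D G (schouten D G) e a b p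
    = covDeriv D G (ricci D G) e a b p - (1 / 6) * pd D e (scalar D G) p * G p a b := by
  have h1 : pd D e (schouten D G a b) p = pd D e (ricci D G a b) p
      - (pd D e (fun q => (1 / 6) * scalar D G q) p * G p a b
        + (1 / 6) * scalar D G p * pd D e (fun q => G q a b) p) := by
    rw [← pd_mul hG.uniqueDiffOn (contDiffOn_const.mul hG.smooth_scalar) (hG.smooth a b) hp,
      ← pd_sub hG.uniqueDiffOn (hG.smooth_ricci a b)
        ((contDiffOn_const.mul hG.smooth_scalar).mul (hG.smooth a b)) hp]
    exact pd_congr (fun q _ => by simp only [schouten]; ring) hp e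
  have h2 : ∑ l, (christoffel D G l e a p * schouten D G l b p
      + christoffel D G l e b p * schouten D G a l p)
      = ∑ l, (christoffel D G l e a p * ricci D G l b p
        + christoffel D G l e b p * ricci D G a l p)
      - 1 / 6 * scalar D G p * ∑ l, (christoffel D G l e a p * G p l b
        + christoffel D G l e b p * G p a l) := by
    rw [Finset.mul_sum, ← Finset.sum_sub_distrib]
    exact Finset.sum_congr rfl fun l _ => by simp only [schouten]; ring
  rw [covDeriv, h1, h2, pd_const_mul hG.uniqueDiffOn _ hG.smooth_scalar hp, hG.pd_metric hp,
    covDeriv]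
  ring

lemma covDeriv₄_weyl (hp : p ∈ D) (e a b c d : Fin 4) :
    covDeriv₄ D G (weyl D G) e a b c d p = covDeriv₄ D G (riemann D G) e a b c d p
      - (1 / 2) * (covDeriv D G (schouten D G) e a c p * G p b d
          - covDeriv D G (schouten D G) e a d p * G p b c
        + (covDeriv D G (schouten D G) e b d p * G p a c
          - covDeriv D G (schouten D G) e b c p * G p a d)) := by
  have hS := hG.smooth_schouten
  let K : Fin 4 → Fin 4 → Fin 4 → Fin 4 → Coord4 → ℝ := fun a b c d q =>
    schouten D G a c q * G q b d
  have hK : ∀ a b c d, ContDiffOn ℝ ∞ (K a b c d) D := fun a b c d => (hS a c).mul (hG.smooth b d)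
  have hK' : ∀ e a b c d, covDeriv₄ D G K e a b c d p
      = covDeriv D G (schouten D G) e a c p * G p b d := hG.covDeriv₄_mul_metric hS hp
  rw [covDeriv₄_congr (Q := fun a b c d q => riemann D G a b c d q
      - (1 / 2) * (K a b c d q - K a b d c q + (K b a d c q - K b a c d q)))
      (fun q _ a b c d => weyl_eq a b c d q) hp,
    hG.covDeriv₄_sub hG.smooth_riemann (fun a b c d => contDiffOn_const.mul
      (((hK _ _ _ _).sub (hK _ _ _ _)).add ((hK _ _ _ _).sub (hK _ _ _ _)))) hp,
    hG.covDeriv₄_const_mul _ (fun a b c d =>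
      (((hK _ _ _ _).sub (hK _ _ _ _)).add ((hK _ _ _ _).sub (hK _ _ _ _)))) hp,
    hG.covDeriv₄_add (fun a b c d => (hK _ _ _ _).sub (hK _ _ _ _))
      (fun a b c d => (hK _ _ _ _).sub (hK _ _ _ _)) hp,
    hG.covDeriv₄_sub (fun a b c d => hK _ _ _ _) (fun a b c d => hK _ _ _ _) hp,
    hG.covDeriv₄_sub (fun a b c d => hK _ _ _ _) (fun a b c d => hK _ _ _ _) hp,
    covDeriv₄_swap_right K, covDeriv₄_swap_left K,
    covDeriv₄_swap_right (fun a b c d => K b a c d), covDeriv₄_swap_left K]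
  simp only [hK']

lemma sum_inv_mul_metric (hp : p ∈ D) (v : Fin 4 → ℝ) (c : Fin 4) :
    ∑ a, ∑ e, (G p)⁻¹ a e * (v e * G p a c) = v c := by
  rw [Finset.sum_comm]
  have h : ∀ e, ∑ a, (G p)⁻¹ a e * (v e * G p a c) = v e * (1 : Matrix (Fin 4) (Fin 4) ℝ) e c := by
    intro e
    rw [← hG.inv_mul hp, Matrix.mul_apply, Finset.mul_sum]
    refine Finset.sum_congr rfl fun a _ => ?_
    rw [hG.inv_symm_apply hp a e]
    ring
  simp [h, Matrix.one_apply]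

/-- Here 1/3 = 1/2 - 1/6, from the divergences of Ricci and of (R/6)γ. -/
lemma div_schouten (hp : p ∈ D) (c : Fin 4) :
    ∑ a, ∑ e, (G p)⁻¹ a e * covDeriv D G (schouten D G) e a c p
      = (1 / 3) * pd D c (scalar D G) p := by
  simp only [hG.covDeriv_schouten hp, mul_sub, Finset.sum_sub_distrib, hG.contracted_bianchi hp]
  rw [hG.sum_inv_mul_metric hp (fun e => 1 / 6 * pd D e (scalar D G) p)]
  ring

/-- The contracted second Bianchi identity for the Weyl tensor, `D^a W_{abcd} = C_{bdc} / 2`. -/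
theorem div₄_weyl (hp : p ∈ D) (b c d : Fin 4) :
    div₄ D G (weyl D G) b c d p = (1 / 2) * cotton D G b d c p := by
  have hR := hG.div₄_riemann hp b c d
  rw [div₄] at hR ⊢
  simp only [hG.covDeriv₄_weyl hp]
  have h1 : ∀ x a e, (G p)⁻¹ a e * (x - 1 / 2 *
      (covDeriv D G (schouten D G) e a c p * G p b d - covDeriv D G (schouten D G) e a d p * G p b c
        + (covDeriv D G (schouten D G) e b d p * G p a c
          - covDeriv D G (schouten D G) e b c p * G p a d)))
      = (G p)⁻¹ a e * x
        - 1 / 2 * (((G p)⁻¹ a e * covDeriv D G (schouten D G) e a c p) * G p b d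
          - ((G p)⁻¹ a e * covDeriv D G (schouten D G) e a d p) * G p b c
          + ((G p)⁻¹ a e * (covDeriv D G (schouten D G) e b d p * G p a c)
          - (G p)⁻¹ a e * (covDeriv D G (schouten D G) e b c p * G p a d))) := by
    intros; ring
  simp only [h1, Finset.sum_sub_distrib, Finset.sum_add_distrib, ← Finset.mul_sum, ← Finset.sum_mul]
  rw [hR, hG.div_schouten hp, hG.div_schouten hp,
    hG.sum_inv_mul_metric hp (fun e => covDeriv D G (schouten D G) e b d p),
    hG.sum_inv_mul_metric hp (fun e => covDeriv D G (schouten D G) e b c p)]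
  -- In terms of the Schouten tensor the curvature divergence has scalar terms with factor 1/6; they
  -- cancel against 1/2 · 1/3 from `div_schouten`.
  simp only [cotton, hG.covDeriv_schouten hp]
  ring

lemma ricci_symm (hp : p ∈ D) (b d : Fin 4) : ricci D G b d p = ricci D G d b p := by
  unfold ricci
  rw [Finset.sum_comm]
  refine Finset.sum_congr rfl fun a _ => Finset.sum_congr rfl fun c _ => ?_
  rw [hG.inv_symm_apply hp c a, hG.riemann_pair_symm hp]

lemma schouten_symm (hp : p ∈ D) (b d : Fin 4) : schouten D G b d p = schouten D G d b p := by
  rw [schouten, schouten, hG.ricci_symm hp, hG.symm_apply hp]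

lemma weyl_swap_left (hp : p ∈ D) (a b c d : Fin 4) : weyl D G a b c d p = -weyl D G b a c d p := by
  rw [weyl_eq, weyl_eq, hG.riemann_swap_left hp]
  ring

lemma weyl_pair_symm (hp : p ∈ D) (a b c d : Fin 4) : weyl D G a b c d p = weyl D G c d a b p := by
  rw [weyl_eq, weyl_eq, hG.riemann_pair_symm hp, hG.schouten_symm hp c a, hG.schouten_symm hp c b,
    hG.schouten_symm hp d a, hG.schouten_symm hp d b, hG.symm_apply hp c a, hG.symm_apply hp c b,
    hG.symm_apply hp d a, hG.symm_apply hp d b]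
  ring

/-- With γ^{ac}γ_{ac} = 4 the trace is Ric - (Rγ + 2 Ric)/2 + (R/6) · 3γ = 0; the dimension enters
only here. -/
lemma weyl_trace (hp : p ∈ D) (b d : Fin 4) :
    ∑ a, ∑ c, (G p)⁻¹ a c * weyl D G a b c d p = 0 := by
  have h1 : ∀ a c, (G p)⁻¹ a c * weyl D G a b c d p = (G p)⁻¹ a c * riemann D G a b c d p
      - 1 / 2 * (((G p)⁻¹ a c * ricci D G a c p) * G p b d
          - (G p)⁻¹ a c * (G p b c * ricci D G a d p)
          + ((G p)⁻¹ a c * G p a c) * ricci D G b d p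
          - (G p)⁻¹ a c * (ricci D G b c p * G p a d))
      + scalar D G p / 6 * (((G p)⁻¹ a c * G p a c) * G p b d
          - (G p)⁻¹ a c * (G p b c * G p a d)) := by
    intro a c; rw [weyl]; ring
  have h2 : ∑ a, ∑ c, (G p)⁻¹ a c * G p a c = 4 := by
    have := congrArg Matrix.trace (hG.inv_mul hp)
    simp only [Matrix.trace_one, Fintype.card_fin] at this
    rw [Matrix.trace] at this
    simp only [Matrix.diag, Matrix.mul_apply] at this
    simpa only [hG.symm_apply hp, Nat.cast_ofNat] using this
  have h3 : ∑ a, ∑ c, (G p)⁻¹ a c * (G p b c * ricci D G a d p) = ricci D G b d p := by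
    rw [← hG.sum_inv_mul_metric hp (fun e => ricci D G e d p) b, Finset.sum_comm]
    refine Finset.sum_congr rfl fun a _ => Finset.sum_congr rfl fun c _ => ?_
    rw [hG.inv_symm_apply hp c a, hG.symm_apply hp b a]
    ring
  have hs : ∑ a, ∑ c, (G p)⁻¹ a c * ricci D G a c p = scalar D G p := rfl
  have hr : ∑ a, ∑ c, (G p)⁻¹ a c * riemann D G a b c d p = ricci D G b d p := rfl
  simp only [h1, Finset.sum_sub_distrib, Finset.sum_add_distrib, ← Finset.mul_sum,
    ← Finset.sum_mul]
  rw [hs, hr, h2, h3, hG.sum_inv_mul_metric hp (fun e => ricci D G b e p) d,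
    hG.sum_inv_mul_metric hp (fun e => G p b e) d]
  ring

end IsMetric

end Coord4

/-! ### Algebraic curvature tensors, in particular in dimension three. -/

/-- A `(0,4)`-tensor with the symmetries `V_{abcd} = -V_{bacd} = -V_{abdc} = V_{cdab}`. -/
structure IsCurvatureLike {ι : Type*} (V : ι → ι → ι → ι → ℝ) : Prop where
  swap_left : ∀ a b c d, V a b c d = -V b a c d
  swap_right : ∀ a b c d, V a b c d = -V a b d c
  pair_symm : ∀ a b c d, V a b c d = V c d a b

/-- The Kulkarni-Nomizu product of two symmetric `(0,2)`-tensors. -/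
def kulkarniNomizu {ι : Type*} (A B : Matrix ι ι ℝ) (a b c d : ι) : ℝ :=
  A a c * B b d + A b d * B a c - A a d * B b c - A b c * B a d

/-- All four indices of a `(0,4)`-tensor moved by the matrix `Q`. -/
def raise₄ {ι : Type*} [Fintype ι] (Q : Matrix ι ι ℝ) (V : ι → ι → ι → ι → ℝ) (a b c d : ι) : ℝ :=
  ∑ a', ∑ b', ∑ c', ∑ d', Q a a' * Q b b' * Q c c' * Q d d' * V a' b' c' d'

lemma isCurvatureLike_kulkarniNomizu {ι : Type*} {A B : Matrix ι ι ℝ} (hA : A.IsSymm)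
    (hB : B.IsSymm) : IsCurvatureLike (kulkarniNomizu A B) where
  swap_left a b c d := by simp only [kulkarniNomizu]; ring
  swap_right a b c d := by simp only [kulkarniNomizu]; ring
  pair_symm a b c d := by
    simp only [kulkarniNomizu]
    rw [hA.apply c a, hA.apply c b, hA.apply d a, hA.apply d b,
      hB.apply c a, hB.apply c b, hB.apply d a, hB.apply d b]
    ring

lemma IsCurvatureLike.ext_fin_three {V V' : Fin 3 → Fin 3 → Fin 3 → Fin 3 → ℝ}
    (hV : IsCurvatureLike V) (hV' : IsCurvatureLike V')
    (h : ∀ a b c d, a < b → c < d → V a b c d = V' a b c d) : V = V' := by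
  have key : ∀ {W : Fin 3 → Fin 3 → Fin 3 → Fin 3 → ℝ}, IsCurvatureLike W →
      ∀ a c d, W a a c d = 0 := fun hW a c d => by linarith [hW.swap_left a a c d]
  have h1 : ∀ a b c d, c < d → V a b c d = V' a b c d := by
    intro a b c d hcd
    rcases lt_trichotomy a b with hab | rfl | hab
    · exact h a b c d hab hcd
    · rw [key hV, key hV']
    · rw [hV.swap_left, hV'.swap_left, h b a c d hab hcd]
  funext a b c d
  rcases lt_trichotomy c d with hcd | rfl | hcd
  · exact h1 a b c d hcd
  · rw [hV.pair_symm, hV'.pair_symm, key hV, key hV']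
  · rw [hV.swap_right, hV'.swap_right, h1 a b d c hcd]

/-- In dimension three, a trace-free curvature tensor is determined by its Ricci tensor. -/
lemma IsCurvatureLike.eq_kulkarniNomizu {V : Fin 3 → Fin 3 → Fin 3 → Fin 3 → ℝ}
    (hV : IsCurvatureLike V) {g E : Matrix (Fin 3) (Fin 3) ℝ} (hg : g.IsSymm)
    (hdet : IsUnit g.det) (hE : ∀ i j, E i j = ∑ k, ∑ l, g⁻¹ k l * V k i l j)
    (htr : ∑ i, ∑ j, g⁻¹ i j * E i j = 0) : V = kulkarniNomizu g E := by
  -- E and its trace are polynomial in the inverse metric, so that is taken as the variable and g is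
  -- expressed through it.
  obtain ⟨q, hq⟩ : ∃ q, q = g⁻¹ := ⟨_, rfl⟩
  have hqs : q.IsSymm := hq ▸ hg.inv
  have hgq : g = q⁻¹ := by rw [hq, Matrix.nonsing_inv_nonsing_inv _ hdet]
  have hqd : q.det ≠ 0 := by
    rw [hq, Matrix.det_nonsing_inv, Ring.inverse_eq_inv']
    exact inv_ne_zero hdet.ne_zero
  rw [← hq] at hE htr
  have hEs : E.IsSymm := by
    ext i j
    rw [Matrix.transpose_apply, hE, hE, Finset.sum_comm]
    refine Finset.sum_congr rfl fun k _ => Finset.sum_congr rfl fun l _ => ?_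
    rw [hqs.apply k l, hV.pair_symm]
  refine hV.ext_fin_three (isCurvatureLike_kulkarniNomizu hg hEs) ?_
  -- Multiplication by det q replaces g by the adjugate of q and leaves polynomial identities.
  suffices h : ∀ a b c d, a < b → c < d →
      q.det * V a b c d = kulkarniNomizu q.adjugate E a b c d by
    intro a b c d hab hcd
    have h1 := h a b c d hab hcd
    have h2 : kulkarniNomizu g E a b c d = q.det⁻¹ * kulkarniNomizu q.adjugate E a b c d := by
      simp only [kulkarniNomizu, hgq, Matrix.inv_def, Ring.inverse_eq_inv', Matrix.smul_apply,
        smul_eq_mul]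
      ring
    rw [h2, ← h1, inv_mul_cancel_left₀ hqd]
  have z : ∀ a c d, V a a c d = 0 := fun a c d => by linarith [hV.swap_left a a c d]
  have z' : ∀ a c d, V c d a a = 0 := fun a c d => by rw [hV.pair_symm, z]
  have hpair : ∀ a b : Fin 3, a < b → (a = 0 ∧ b = 1) ∨ (a = 0 ∧ b = 2) ∨ (a = 1 ∧ b = 2) := by
    decide
  have q10 := hqs.apply 0 1
  have q20 := hqs.apply 0 2
  have q21 := hqs.apply 1 2
  have l10 := hV.swap_left 1 0
  have l20 := hV.swap_left 2 0
  have l21 := hV.swap_left 2 1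
  have r10 := fun a b => hV.swap_right a b 1 0
  have r20 := fun a b => hV.swap_right a b 2 0
  have r21 := fun a b => hV.swap_right a b 2 1
  have p1 := hV.pair_symm 0 2 0 1
  have p2 := hV.pair_symm 1 2 0 1
  have p3 := hV.pair_symm 1 2 0 2
  intro a b c d hab hcd
  simp only [hE, Fin.sum_univ_three, z, z', q10, q20, q21, l10, l20, l21, r10, r20, r21, p1, p2,
    p3] at htr
  rcases hpair a b hab with ⟨rfl, rfl⟩ | ⟨rfl, rfl⟩ | ⟨rfl, rfl⟩ <;>
  rcases hpair c d hcd with ⟨rfl, rfl⟩ | ⟨rfl, rfl⟩ | ⟨rfl, rfl⟩ <;>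
  simp only [kulkarniNomizu, Matrix.adjugate_fin_three, Matrix.det_fin_three, hE,
    Fin.sum_univ_three, z, z', q10, q20, q21, l10, l20, l21, r10, r20, r21, p1, p2, p3,
    Matrix.of_apply, Matrix.cons_val]
  -- For the pairs (a, b) and (c, d) with complementary indices m and n, the two sides differ by
  -- (-1)^(m+n+1) q_{mn}/2 times the trace of E.
  · linear_combination (-(1 / 2) * q 2 2) * htr
  · linear_combination ((1 / 2) * q 1 2) * htr
  · linear_combination (-(1 / 2) * q 0 2) * htr
  · linear_combination ((1 / 2) * q 1 2) * htr
  · linear_combination (-(1 / 2) * q 1 1) * htr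
  · linear_combination ((1 / 2) * q 0 1) * htr
  · linear_combination (-(1 / 2) * q 0 2) * htr
  · linear_combination ((1 / 2) * q 0 1) * htr
  · linear_combination (-(1 / 2) * q 0 0) * htr

/-! ### Raising indices, and contractions written as traces. -/

section

variable {ι : Type*} [Fintype ι]

lemma mul_mul_transpose_apply (Q A : Matrix ι ι ℝ) (a c : ι) :
    (Q * A * Q.transpose) a c = ∑ a', ∑ c', Q a a' * A a' c' * Q c c' := by
  simp only [Matrix.mul_apply, Matrix.transpose_apply, Finset.sum_mul]
  exact Finset.sum_comm

lemma raise₄_mul (Q A B : Matrix ι ι ℝ) (a b c d : ι) :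
    raise₄ Q (fun a b c d => A a c * B b d) a b c d
      = (Q * A * Q.transpose) a c * (Q * B * Q.transpose) b d := by
  rw [mul_mul_transpose_apply, mul_mul_transpose_apply, raise₄, Finset.sum_mul]
  refine Finset.sum_congr rfl fun a' _ => ?_
  rw [Finset.sum_comm, Finset.sum_mul]
  refine Finset.sum_congr rfl fun c' _ => ?_
  rw [Finset.mul_sum]
  refine Finset.sum_congr rfl fun b' _ => ?_
  rw [Finset.mul_sum]
  exact Finset.sum_congr rfl fun d' _ => by ring

lemma raise₄_swap_right (Q : Matrix ι ι ℝ) (V : ι → ι → ι → ι → ℝ) (a b c d : ι) :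
    raise₄ Q (fun a b c d => V a b d c) a b c d = raise₄ Q V a b d c := by
  unfold raise₄
  refine Finset.sum_congr rfl fun a' _ => Finset.sum_congr rfl fun b' _ => ?_
  rw [Finset.sum_comm]
  exact Finset.sum_congr rfl fun c' _ => Finset.sum_congr rfl fun d' _ => by ring

lemma raise₄_kulkarniNomizu (Q A B : Matrix ι ι ℝ) (a b c d : ι) :
    raise₄ Q (kulkarniNomizu A B) a b c d
      = kulkarniNomizu (Q * A * Q.transpose) (Q * B * Q.transpose) a b c d := by
  have h : raise₄ Q (kulkarniNomizu A B) a b c d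
      = raise₄ Q (fun a b c d => A a c * B b d) a b c d
      + raise₄ Q (fun a b c d => B a c * A b d) a b c d
      - raise₄ Q (fun a b c d => A a d * B b c) a b c d
      - raise₄ Q (fun a b c d => B a d * A b c) a b c d := by
    simp only [raise₄, ← Finset.sum_add_distrib, ← Finset.sum_sub_distrib]
    refine Finset.sum_congr rfl fun a' _ => Finset.sum_congr rfl fun b' _ =>
      Finset.sum_congr rfl fun c' _ => Finset.sum_congr rfl fun d' _ => ?_
    simp only [kulkarniNomizu]
    ring
  rw [h, raise₄_mul, raise₄_mul, raise₄_swap_right Q (fun a b c d => A a c * B b d),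
    raise₄_swap_right Q (fun a b c d => B a c * A b d), raise₄_mul, raise₄_mul]
  simp only [kulkarniNomizu]
  ring

/-- By the symmetries of V each of the four terms of the product contracts V to its Ricci tensor,
with signs that make all contributions equal. -/
lemma IsCurvatureLike.sum_mul_kulkarniNomizu {V : ι → ι → ι → ι → ℝ} (hV : IsCurvatureLike V)
    {q E : Matrix ι ι ℝ} (hE : ∀ i j, E i j = ∑ k, ∑ l, q k l * V k i l j) (F : Matrix ι ι ℝ) :
    ∑ a, ∑ b, ∑ c, ∑ d, V a b c d * kulkarniNomizu q F a b c d
      = 4 * ∑ i, ∑ j, E i j * F i j := by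
  have h1 : ∑ a, ∑ b, ∑ c, ∑ d, V a b c d * (q a c * F b d) = ∑ i, ∑ j, E i j * F i j := by
    rw [Finset.sum_comm]
    refine Finset.sum_congr rfl fun b _ => ?_
    rw [← Coord4.sum_comm₃ fun d a c => V a b c d * (q a c * F b d)]
    refine Finset.sum_congr rfl fun d _ => ?_
    simp only [hE, Finset.sum_mul]
    exact Finset.sum_congr rfl fun a _ => Finset.sum_congr rfl fun c _ => by ring
  have h2 : ∑ a, ∑ b, ∑ c, ∑ d, V a b c d * (q b d * F a c) = ∑ i, ∑ j, E i j * F i j := by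
    rw [← h1, Finset.sum_comm]
    refine Finset.sum_congr rfl fun a _ => Finset.sum_congr rfl fun b _ => ?_
    rw [Finset.sum_comm]
    refine Finset.sum_congr rfl fun c _ => Finset.sum_congr rfl fun d _ => ?_
    rw [hV.swap_left, hV.swap_right, neg_neg]
  have h3 : ∑ a, ∑ b, ∑ c, ∑ d, V a b c d * (q a d * F b c) = -∑ i, ∑ j, E i j * F i j := by
    rw [← h1]
    simp only [← Finset.sum_neg_distrib]
    refine Finset.sum_congr rfl fun a _ => Finset.sum_congr rfl fun b _ => ?_
    rw [Finset.sum_comm]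
    refine Finset.sum_congr rfl fun c _ => Finset.sum_congr rfl fun d _ => ?_
    rw [hV.swap_right, neg_mul]
  have h4 : ∑ a, ∑ b, ∑ c, ∑ d, V a b c d * (q b c * F a d) = -∑ i, ∑ j, E i j * F i j := by
    rw [← h1, Finset.sum_comm]
    simp only [← Finset.sum_neg_distrib]
    refine Finset.sum_congr rfl fun a _ => Finset.sum_congr rfl fun b _ =>
      Finset.sum_congr rfl fun c _ => Finset.sum_congr rfl fun d _ => ?_
    rw [hV.swap_left, neg_mul]
  simp only [kulkarniNomizu, mul_sub, mul_add, Finset.sum_sub_distrib, Finset.sum_add_distrib, h1,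
    h2, h3, h4]
  ring

lemma sum_mul_eq_trace {B : Matrix ι ι ℝ} (hB : B.IsSymm) (A : Matrix ι ι ℝ) :
    ∑ i, ∑ j, A i j * B i j = (A * B).trace := by
  rw [Matrix.trace]
  simp only [Matrix.diag, Matrix.mul_apply]
  exact Finset.sum_congr rfl fun l _ => Finset.sum_congr rfl fun m _ => by rw [hB.apply]

lemma isSymm_mul_mul_transpose {A : Matrix ι ι ℝ} (hA : A.IsSymm) (Q : Matrix ι ι ℝ) :
    (Q * A * Q.transpose).IsSymm := by
  rw [Matrix.IsSymm, Matrix.transpose_mul, Matrix.transpose_mul, hA.eq, Matrix.transpose_transpose,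
    mul_assoc]

/-- This and `sum_contract_three` turn the index sums of the statement into traces, where cyclicity
replaces the renaming of indices. -/
lemma sum_contract_two {q B : Matrix ι ι ℝ} (hq : q.IsSymm) (hB : B.IsSymm) (A : Matrix ι ι ℝ) :
    ∑ i, ∑ j, ∑ i', ∑ j', q i i' * q j j' * A i j * B i' j' = (q * A * q * B).trace := by
  have h : (q * A * q * B).trace = (A * (q * B * q.transpose)).trace := by
    rw [hq.eq, mul_assoc q A, mul_assoc q, Matrix.trace_mul_comm]
    simp only [mul_assoc]
  have hs := isSymm_mul_mul_transpose hB q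
  rw [h, ← sum_mul_eq_trace hs]
  simp only [mul_mul_transpose_apply, Finset.mul_sum]
  exact Finset.sum_congr rfl fun i _ => Finset.sum_congr rfl fun j _ =>
    Finset.sum_congr rfl fun i' _ => Finset.sum_congr rfl fun j' _ => by ring

lemma sum_contract_three {q h E : Matrix ι ι ℝ} (hq : q.IsSymm) (hh : h.IsSymm) (hE : E.IsSymm) :
    ∑ i, ∑ j, ∑ l, ∑ i', ∑ j', ∑ l', q i i' * q j j' * q l l' * h j l * E i j' * E i' l'
      = (q * h * q * E * q * E).trace := by
  have h1 : (q * h * q * E * q * E).trace = (q * (E * q * h * (E * q).transpose)).trace := by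
    rw [Matrix.transpose_mul, hq.eq, hE.eq, mul_assoc _ q E, Matrix.trace_mul_comm]
    simp only [mul_assoc]
  have hs := isSymm_mul_mul_transpose hh (E * q)
  rw [h1, ← sum_mul_eq_trace hs]
  refine Finset.sum_congr rfl fun i _ => ?_
  rw [← Coord4.sum_comm₃ fun i' j l => ∑ j', ∑ l',
    q i i' * q j j' * q l l' * h j l * E i j' * E i' l']
  refine Finset.sum_congr rfl fun i' _ => ?_
  simp only [mul_mul_transpose_apply, Finset.mul_sum]
  refine Finset.sum_congr rfl fun j _ => Finset.sum_congr rfl fun l _ => ?_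
  simp only [Matrix.mul_apply, Finset.mul_sum, Finset.sum_mul]
  rw [Finset.sum_comm]
  exact Finset.sum_congr rfl fun j' _ => Finset.sum_congr rfl fun l' _ => by
    rw [hq.apply j l', hq.apply l j']
    ring

lemma isSymm_mul_mul {A B : Matrix ι ι ℝ} (hA : A.IsSymm) (hB : B.IsSymm) :
    (A * B * A).IsSymm := by
  simpa only [hA.eq] using isSymm_mul_mul_transpose hB A

end

/-- The squared norm of a trace-free curvature tensor in dimension three, by its Ricci tensor. -/
lemma IsCurvatureLike.sum_mul_raise₄ {V : Fin 3 → Fin 3 → Fin 3 → Fin 3 → ℝ}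
    (hV : IsCurvatureLike V) {g E : Matrix (Fin 3) (Fin 3) ℝ} (hg : g.IsSymm)
    (hdet : IsUnit g.det) (hE : ∀ i j, E i j = ∑ k, ∑ l, g⁻¹ k l * V k i l j)
    (htr : ∑ i, ∑ j, g⁻¹ i j * E i j = 0) :
    ∑ a, ∑ b, ∑ c, ∑ d, V a b c d * raise₄ g⁻¹ V a b c d
      = 4 * ∑ i, ∑ j, E i j * (g⁻¹ * E * g⁻¹) i j := by
  -- Raising indices respects the Kulkarni-Nomizu product and turns g into its inverse.
  have h1 : raise₄ g⁻¹ V = kulkarniNomizu g⁻¹ (g⁻¹ * E * g⁻¹) := by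
    funext a b c d
    conv_lhs => rw [hV.eq_kulkarniNomizu hg hdet hE htr]
    rw [raise₄_kulkarniNomizu, hg.inv.eq, Matrix.nonsing_inv_mul _ hdet, one_mul]
  rw [h1, hV.sum_mul_kulkarniNomizu hE]

/-- Used with B = qhq, for the spatial Weyl tensor contracted with h in the divergence. -/
lemma sum_mul_kulkarniNomizu {ι : Type*} [Fintype ι] {g E B : Matrix ι ι ℝ}
    (hg : g.IsSymm) (hE : E.IsSymm) (hB : B.IsSymm) (i j : ι) :
    ∑ l, ∑ m, B l m * kulkarniNomizu g E l i m j
      = ((B * g).trace • E + (B * E).trace • g - E * B * g - g * B * E) i j := by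
  have h2 : ∀ A C : Matrix ι ι ℝ, (A * B * C) i j = ∑ l, ∑ m, B l m * (A i m * C l j) := by
    intro A C
    simp only [Matrix.mul_apply, Finset.sum_mul]
    exact Finset.sum_congr rfl fun l _ => Finset.sum_congr rfl fun m _ => by
      rw [hB.apply l m]; ring
  simp only [Matrix.sub_apply, Matrix.add_apply, Matrix.smul_apply, smul_eq_mul]
  rw [← sum_mul_eq_trace hg, ← sum_mul_eq_trace hE, h2 E g, h2 g E]
  simp only [Finset.sum_mul, ← Finset.sum_add_distrib, ← Finset.sum_sub_distrib]
  refine Finset.sum_congr rfl fun l _ => Finset.sum_congr rfl fun m _ => ?_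
  simp only [kulkarniNomizu]
  ring

/-! ### Block diagonal matrices. -/

/-- The block diagonal matrix with blocks of size one and three. -/
def blockMatrix (a : ℝ) (A : Matrix (Fin 3) (Fin 3) ℝ) : Matrix (Fin 4) (Fin 4) ℝ :=
  Matrix.of fun α β => Fin.cases (Fin.cases a (fun _ => 0) β)
    (fun i => Fin.cases 0 (fun j => A i j) β) α

section blockMatrix

variable (a : ℝ) (A : Matrix (Fin 3) (Fin 3) ℝ)

@[simp] lemma blockMatrix_zero_zero : blockMatrix a A 0 0 = a := rfl

@[simp] lemma blockMatrix_zero_succ (i : Fin 3) : blockMatrix a A 0 i.succ = 0 := rfl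

@[simp] lemma blockMatrix_succ_zero (i : Fin 3) : blockMatrix a A i.succ 0 = 0 := rfl

@[simp] lemma blockMatrix_succ_succ (i j : Fin 3) : blockMatrix a A i.succ j.succ = A i j := rfl

lemma sum_fin_four (f : Fin 4 → ℝ) : ∑ i, f i = f 0 + ∑ i : Fin 3, f i.succ :=
  Fin.sum_univ_succ f

lemma blockMatrix_mul (b : ℝ) (B : Matrix (Fin 3) (Fin 3) ℝ) :
    blockMatrix a A * blockMatrix b B = blockMatrix (a * b) (A * B) := by
  ext α β
  rw [Matrix.mul_apply, sum_fin_four]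
  induction α using Fin.cases <;> induction β using Fin.cases <;> simp [Matrix.mul_apply]

lemma blockMatrix_one : blockMatrix 1 1 = 1 := by
  ext α β
  induction α using Fin.cases <;> induction β using Fin.cases <;>
    simp [Matrix.one_apply, Fin.succ_ne_zero, (Fin.succ_ne_zero _).symm]

variable {a A}

lemma blockMatrix_mul_inv (ha : a ≠ 0) (hA : IsUnit A.det) :
    blockMatrix a A * blockMatrix a⁻¹ A⁻¹ = 1 := by
  rw [blockMatrix_mul, mul_inv_cancel₀ ha, Matrix.mul_nonsing_inv _ hA, blockMatrix_one]

lemma blockMatrix_inv (ha : a ≠ 0) (hA : IsUnit A.det) :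
    (blockMatrix a A)⁻¹ = blockMatrix a⁻¹ A⁻¹ :=
  Matrix.inv_eq_right_inv (blockMatrix_mul_inv ha hA)

lemma blockMatrix_isSymm (hA : A.IsSymm) : (blockMatrix a A).IsSymm := by
  ext α β
  rw [Matrix.transpose_apply]
  induction α using Fin.cases <;> induction β using Fin.cases <;> simp [hA.apply]

end blockMatrix

/-! ### The metric -N² dt² + g: Christoffel symbols and electric part of the Weyl tensor. -/

namespace Coord4

/-- The matrix of the metric `-N² dt² + g`. -/
def lapseMetric (N : Coord4 → ℝ) (g : Coord4 → Matrix (Fin 3) (Fin 3) ℝ) (p : Coord4) :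
    Matrix (Fin 4) (Fin 4) ℝ :=
  blockMatrix (-(N p) ^ 2) (g p)

/-- The data `(N, g)` of a metric `-N² dt² + g` on a coordinate domain. -/
structure IsFoliated (D : Set Coord4) (N : Coord4 → ℝ) (g : Coord4 → Matrix (Fin 3) (Fin 3) ℝ) :
    Prop where
  uniqueDiffOn : UniqueDiffOn ℝ D
  subset_closure : D ⊆ closure (interior D)
  smooth_lapse : ContDiffOn ℝ ∞ N D
  lapse_ne_zero : ∀ q ∈ D, N q ≠ 0
  smooth : SmoothMat D g
  symm : ∀ q ∈ D, (g q).IsSymm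
  isUnit_det : ∀ q ∈ D, IsUnit (g q).det

/-- The second fundamental form `-(1 / (2 N)) ∂_t g`. -/
noncomputable def secondFundamentalForm (D : Set Coord4) (N : Coord4 → ℝ)
    (g : Coord4 → Matrix (Fin 3) (Fin 3) ℝ) (p : Coord4) : Matrix (Fin 3) (Fin 3) ℝ :=
  Matrix.of fun i j => -(1 / (2 * N p)) * pd D 0 (fun q => g q i j) p

/-- The electric part `W_{TiTj}` of the Weyl tensor. -/
noncomputable def electric (D : Set Coord4) (N : Coord4 → ℝ)
    (g : Coord4 → Matrix (Fin 3) (Fin 3) ℝ) (p : Coord4) : Matrix (Fin 3) (Fin 3) ℝ :=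
  Matrix.of fun i j => (N p)⁻¹ * (N p)⁻¹ * weyl D (lapseMetric N g) 0 i.succ 0 j.succ p

/-- The components `C_{ijT}` of the Cotton tensor. -/
noncomputable def normalCotton (D : Set Coord4) (N : Coord4 → ℝ)
    (g : Coord4 → Matrix (Fin 3) (Fin 3) ℝ) (p : Coord4) : Matrix (Fin 3) (Fin 3) ℝ :=
  Matrix.of fun i j => (N p)⁻¹ * cotton D (lapseMetric N g) i.succ j.succ 0 p

/-- The spatial components of the Weyl tensor. -/
noncomputable def spatialWeyl (D : Set Coord4) (N : Coord4 → ℝ)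
    (g : Coord4 → Matrix (Fin 3) (Fin 3) ℝ) (p : Coord4) (i j k l : Fin 3) : ℝ :=
  weyl D (lapseMetric N g) i.succ j.succ k.succ l.succ p

/-- The vanishing of the components `W_{Tijk}` of the Weyl tensor. -/
def IsElectric (D : Set Coord4) (N : Coord4 → ℝ) (g : Coord4 → Matrix (Fin 3) (Fin 3) ℝ) : Prop :=
  ∀ q ∈ D, ∀ i j k : Fin 3, weyl D (lapseMetric N g) 0 i.succ j.succ k.succ q = 0

namespace IsFoliated

variable {D : Set Coord4} {N : Coord4 → ℝ} {g : Coord4 → Matrix (Fin 3) (Fin 3) ℝ} {p : Coord4}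
  (hF : IsFoliated D N g)
include hF

lemma neg_sq_ne_zero (hp : p ∈ D) : -(N p) ^ 2 ≠ 0 :=
  neg_ne_zero.2 (pow_ne_zero 2 (hF.lapse_ne_zero p hp))

lemma inv_lapseMetric (hp : p ∈ D) :
    (lapseMetric N g p)⁻¹ = blockMatrix (-(N p) ^ 2)⁻¹ (g p)⁻¹ :=
  blockMatrix_inv (hF.neg_sq_ne_zero hp) (hF.isUnit_det p hp)

lemma isMetric : IsMetric D (lapseMetric N g) where
  uniqueDiffOn := hF.uniqueDiffOn
  subset_closure := hF.subset_closure
  smooth α β := by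
    induction α using Fin.cases with
    | zero =>
      induction β using Fin.cases with
      | zero => exact (hF.smooth_lapse.pow 2).neg
      | succ j => exact contDiffOn_const
    | succ i =>
      induction β using Fin.cases with
      | zero => exact contDiffOn_const
      | succ j => exact hF.smooth i j
  symm q hq := blockMatrix_isSymm (hF.symm q hq)
  isUnit_det q hq := Matrix.isUnit_det_of_right_inverse
    (blockMatrix_mul_inv (hF.neg_sq_ne_zero hq) (hF.isUnit_det q hq))

lemma pd_lapse_sq (hp : p ∈ D) (α : Fin 4) :
    pd D α (fun q => N q ^ 2) p = 2 * N p * pd D α N p := by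
  simp only [sq]
  rw [pd_mul hF.uniqueDiffOn hF.smooth_lapse hF.smooth_lapse hp]
  ring

lemma pd_lapseMetric_zero_zero (hp : p ∈ D) (α : Fin 4) :
    pd D α (fun q => lapseMetric N g q 0 0) p = -(2 * N p * pd D α N p) := by
  have h := pd_const_mul hF.uniqueDiffOn (-1) (hF.smooth_lapse.pow 2) hp α
  rw [hF.pd_lapse_sq hp] at h
  rw [← neg_one_mul, ← h]
  exact pd_congr (fun q _ => by simp [lapseMetric]) hp α

omit hF in
lemma pd_lapseMetric_zero_succ (α : Fin 4) (i : Fin 3) :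
    pd D α (fun q => lapseMetric N g q 0 i.succ) p = 0 := pd_const 0 α

omit hF in
lemma pd_lapseMetric_succ_zero (α : Fin 4) (i : Fin 3) :
    pd D α (fun q => lapseMetric N g q i.succ 0) p = 0 := pd_const 0 α

lemma pd_zero_metric (hp : p ∈ D) (i j : Fin 3) :
    pd D 0 (fun q => g q i j) p = -(2 * N p) * secondFundamentalForm D N g p i j := by
  have := hF.lapse_ne_zero p hp
  simp only [secondFundamentalForm, Matrix.of_apply]
  field_simp

lemma pdMat_zero_metric (hp : p ∈ D) :
    pdMat D 0 g p = -(2 * N p) • secondFundamentalForm D N g p := by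
  ext i j
  exact hF.pd_zero_metric hp i j

lemma isSymm_secondFundamentalForm (hp : p ∈ D) : (secondFundamentalForm D N g p).IsSymm := by
  ext i j
  simp only [Matrix.transpose_apply, secondFundamentalForm, Matrix.of_apply]
  rw [pd_congr (fun q hq => (hF.symm q hq).apply i j) hp]

/-- The symbols computed here and below suffice: in the divergence all others multiply components of
W that vanish by skew symmetry or by the purely electric assumption. -/
lemma christoffel_zero_zero_zero (hp : p ∈ D) :
    christoffel D (lapseMetric N g) 0 0 0 p = (N p)⁻¹ * pd D 0 N p := by
  have := hF.lapse_ne_zero p hp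
  rw [christoffel, hF.inv_lapseMetric hp, sum_fin_four]
  simp only [blockMatrix_zero_zero, blockMatrix_zero_succ, hF.pd_lapseMetric_zero_zero hp, zero_mul,
    Finset.sum_const_zero]
  field_simp
  ring

lemma christoffel_zero_succ_succ (hp : p ∈ D) (k l : Fin 3) :
    christoffel D (lapseMetric N g) 0 k.succ l.succ p
      = -((N p)⁻¹ * secondFundamentalForm D N g p k l) := by
  have := hF.lapse_ne_zero p hp
  have h1 : pd D 0 (fun q => lapseMetric N g q k.succ l.succ) p = _ := hF.pd_zero_metric hp k l
  rw [christoffel, hF.inv_lapseMetric hp, sum_fin_four]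
  simp only [blockMatrix_zero_zero, blockMatrix_zero_succ, pd_lapseMetric_zero_succ, h1, zero_mul,
    Finset.sum_const_zero]
  field_simp
  ring

lemma christoffel_succ_zero_succ (hp : p ∈ D) (k i : Fin 3) :
    christoffel D (lapseMetric N g) k.succ 0 i.succ p
      = -(N p * ((g p)⁻¹ * secondFundamentalForm D N g p) k i) := by
  have h1 : ∀ m : Fin 3, pd D 0 (fun q => lapseMetric N g q m.succ i.succ) p = _ :=
    fun m => hF.pd_zero_metric hp m i
  rw [christoffel, hF.inv_lapseMetric hp, sum_fin_four]
  simp only [blockMatrix_succ_zero, blockMatrix_succ_succ, pd_lapseMetric_zero_succ,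
    pd_lapseMetric_succ_zero, h1, zero_mul, Matrix.mul_apply, Finset.mul_sum, zero_add,
    ← Finset.sum_neg_distrib]
  exact Finset.sum_congr rfl fun m _ => by ring

lemma christoffel_succ_succ_zero (hp : p ∈ D) (k i : Fin 3) :
    christoffel D (lapseMetric N g) k.succ i.succ 0 p
      = -(N p * ((g p)⁻¹ * secondFundamentalForm D N g p) k i) := by
  rw [hF.isMetric.christoffel_symm hp, hF.christoffel_succ_zero_succ hp]

lemma isCurvatureLike_weyl (hp : p ∈ D) :
    IsCurvatureLike fun a b c d => weyl D (lapseMetric N g) a b c d p where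
  swap_left := hF.isMetric.weyl_swap_left hp
  swap_right := weyl_swap_right
  pair_symm := hF.isMetric.weyl_pair_symm hp

lemma isCurvatureLike_spatialWeyl (hp : p ∈ D) : IsCurvatureLike (spatialWeyl D N g p) where
  swap_left _ _ _ _ := hF.isMetric.weyl_swap_left hp _ _ _ _
  swap_right _ _ _ _ := weyl_swap_right _ _ _ _
  pair_symm _ _ _ _ := hF.isMetric.weyl_pair_symm hp _ _ _ _

lemma weyl_zero_succ_zero_succ (hp : p ∈ D) (i j : Fin 3) :
    weyl D (lapseMetric N g) 0 i.succ 0 j.succ p = N p ^ 2 * electric D N g p i j := by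
  have := hF.lapse_ne_zero p hp
  simp only [electric, Matrix.of_apply]
  field_simp

lemma smooth_electric : SmoothMat D (electric D N g) := fun i j =>
  (((hF.smooth_lapse.inv hF.lapse_ne_zero).mul (hF.smooth_lapse.inv hF.lapse_ne_zero)).mul
    (hF.isMetric.smooth_weyl 0 i.succ 0 j.succ))

lemma isSymm_electric (hp : p ∈ D) : (electric D N g p).IsSymm := by
  ext i j
  simp only [Matrix.transpose_apply, electric, Matrix.of_apply]
  rw [hF.isMetric.weyl_pair_symm hp]

lemma weyl_same_left (hp : p ∈ D) (a c d : Fin 4) : weyl D (lapseMetric N g) a a c d p = 0 := by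
  linarith [hF.isMetric.weyl_swap_left hp a a c d]

omit hF in
lemma weyl_same_right (a b c : Fin 4) : weyl D (lapseMetric N g) a b c c p = 0 := by
  linarith [weyl_swap_right (D := D) (G := lapseMetric N g) (p := p) a b c c]

/-- In the spatial components of the trace condition, γ^{00} W_{0i0j} = -E_{ij} must be balanced by
the trace of the spatial part. -/
lemma electric_eq_trace (hp : p ∈ D) (i j : Fin 3) :
    electric D N g p i j = ∑ k, ∑ l, (g p)⁻¹ k l * spatialWeyl D N g p k i l j := by
  have h := hF.isMetric.weyl_trace hp i.succ j.succ
  have := hF.lapse_ne_zero p hp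
  rw [hF.inv_lapseMetric hp] at h
  simp only [sum_fin_four, blockMatrix_zero_zero, blockMatrix_zero_succ, blockMatrix_succ_zero,
    blockMatrix_succ_succ, zero_mul, Finset.sum_const_zero, zero_add, add_zero,
    hF.weyl_zero_succ_zero_succ hp] at h
  have h2 : (-N p ^ 2)⁻¹ * (N p ^ 2 * electric D N g p i j) = -electric D N g p i j := by
    field_simp
  rw [h2] at h
  simp only [spatialWeyl]
  linarith

/-- This is the (t, t) component of the trace condition. -/
lemma trace_electric (hp : p ∈ D) : ∑ i, ∑ j, (g p)⁻¹ i j * electric D N g p i j = 0 := by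
  have h := hF.isMetric.weyl_trace hp 0 0
  have hN := hF.lapse_ne_zero p hp
  have hw : ∀ i j : Fin 3, weyl D (lapseMetric N g) i.succ 0 j.succ 0 p
      = N p ^ 2 * electric D N g p i j := fun i j => by
    rw [hF.isMetric.weyl_swap_left hp, weyl_swap_right, neg_neg, hF.weyl_zero_succ_zero_succ hp]
  rw [hF.inv_lapseMetric hp] at h
  simp only [sum_fin_four, blockMatrix_zero_zero, blockMatrix_zero_succ, blockMatrix_succ_zero,
    blockMatrix_succ_succ, zero_mul, Finset.sum_const_zero, zero_add, add_zero,
    hF.weyl_same_left hp, mul_zero, hw] at h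
  have h2 : N p ^ 2 * ∑ i, ∑ j, (g p)⁻¹ i j * electric D N g p i j = 0 := by
    rw [← h, Finset.mul_sum]
    refine Finset.sum_congr rfl fun i _ => ?_
    rw [Finset.mul_sum]
    exact Finset.sum_congr rfl fun j _ => by ring
  exact (mul_eq_zero.1 h2).resolve_left (pow_ne_zero 2 hN)

lemma spatialWeyl_eq (hp : p ∈ D) :
    spatialWeyl D N g p = kulkarniNomizu (g p) (electric D N g p) :=
  (hF.isCurvatureLike_spatialWeyl hp).eq_kulkarniNomizu (hF.symm p hp) (hF.isUnit_det p hp)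
    (hF.electric_eq_trace hp) (hF.trace_electric hp)

variable (hE : IsElectric D N g)
include hE

lemma weyl_succ_succ_zero_succ (hp : p ∈ D) (i j k : Fin 3) :
    weyl D (lapseMetric N g) i.succ j.succ 0 k.succ p = 0 := by
  rw [hF.isMetric.weyl_pair_symm hp, hE p hp]

/-- For a purely electric Weyl tensor `|W|² = 8 |W_{TiTj}|²`. -/
lemma weylNormSq_eq (hp : p ∈ D) : weylNormSq D (lapseMetric N g) p
    = 8 * ((g p)⁻¹ * electric D N g p * (g p)⁻¹ * electric D N g p).trace := by
  have hN := hF.lapse_ne_zero p hp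
  have hS := hF.isCurvatureLike_weyl hp
  obtain ⟨W, hW⟩ : ∃ W : Fin 4 → Fin 4 → Fin 4 → Fin 4 → ℝ,
    W = fun a b c d => weyl D (lapseMetric N g) a b c d p := ⟨_, rfl⟩
  have hWa : ∀ a b c d, weyl D (lapseMetric N g) a b c d p = W a b c d := fun a b c d => by rw [hW]
  rw [← hW] at hS
  have h1 : weylNormSq D (lapseMetric N g) p
      = ∑ a, ∑ b, ∑ c, ∑ d, W a b c d * raise₄ (lapseMetric N g p)⁻¹ W a b c d := by
    simp only [weylNormSq, raise₄, Finset.mul_sum, hWa]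
    refine Finset.sum_congr rfl fun a _ => Finset.sum_congr rfl fun b _ =>
      Finset.sum_congr rfl fun c _ => Finset.sum_congr rfl fun d _ =>
      Finset.sum_congr rfl fun a' _ => Finset.sum_congr rfl fun b' _ =>
      Finset.sum_congr rfl fun c' _ => Finset.sum_congr rfl fun d' _ => by ring
  have h2 : ∀ i j k l : Fin 3,
      raise₄ (lapseMetric N g p)⁻¹ W i.succ j.succ k.succ l.succ
        = raise₄ (g p)⁻¹ (spatialWeyl D N g p) i j k l := fun i j k l => by
    simp only [raise₄, hF.inv_lapseMetric hp, sum_fin_four, blockMatrix_succ_zero,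
      blockMatrix_succ_succ, zero_mul, mul_zero, Finset.sum_const_zero, zero_add, ← hWa, spatialWeyl]
  have w1 : ∀ i j : Fin 3, W 0 i.succ 0 j.succ = N p ^ 2 * electric D N g p i j := fun i j => by
    rw [← hWa, hF.weyl_zero_succ_zero_succ hp]
  have w2 : ∀ i j : Fin 3, W 0 i.succ j.succ 0 = -(N p ^ 2 * electric D N g p i j) := fun i j => by
    rw [hS.swap_right, w1]
  have w3 : ∀ i j : Fin 3, W i.succ 0 0 j.succ = -(N p ^ 2 * electric D N g p i j) := fun i j => by
    rw [hS.swap_left, w1]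
  have w4 : ∀ i j : Fin 3, W i.succ 0 j.succ 0 = N p ^ 2 * electric D N g p i j := fun i j => by
    rw [hS.swap_right, w3, neg_neg]
  have hq : ∀ i j : Fin 3, ((g p)⁻¹ * electric D N g p * (g p)⁻¹) i j
      = ∑ k, ∑ l, (g p)⁻¹ i k * electric D N g p k l * (g p)⁻¹ j l := fun i j => by
    rw [← mul_mul_transpose_apply, (hF.symm p hp).inv.eq]
  -- Two raised time indices give (-N²)⁻² and the two factors W give N⁴, so every placement of two
  -- time indices contributes the same, without sign.
  have r1 : ∀ i j : Fin 3, W 0 i.succ 0 j.succ * raise₄ (lapseMetric N g p)⁻¹ W 0 i.succ 0 j.succ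
      = electric D N g p i j * ((g p)⁻¹ * electric D N g p * (g p)⁻¹) i j := fun i j => by
    simp only [raise₄, hF.inv_lapseMetric hp, sum_fin_four, blockMatrix_succ_zero,
      blockMatrix_succ_succ, blockMatrix_zero_zero, blockMatrix_zero_succ, zero_mul, mul_zero,
      Finset.sum_const_zero, zero_add, add_zero, w1, hq, Finset.mul_sum]
    refine Finset.sum_congr rfl fun k _ => Finset.sum_congr rfl fun l _ => ?_
    field_simp
  have r2 : ∀ i j : Fin 3, W 0 i.succ j.succ 0 * raise₄ (lapseMetric N g p)⁻¹ W 0 i.succ j.succ 0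
      = electric D N g p i j * ((g p)⁻¹ * electric D N g p * (g p)⁻¹) i j := fun i j => by
    simp only [raise₄, hF.inv_lapseMetric hp, sum_fin_four, blockMatrix_succ_zero,
      blockMatrix_succ_succ, blockMatrix_zero_zero, blockMatrix_zero_succ, zero_mul, mul_zero,
      Finset.sum_const_zero, zero_add, add_zero, w2, hq, Finset.mul_sum]
    refine Finset.sum_congr rfl fun k _ => Finset.sum_congr rfl fun l _ => ?_
    field_simp
  have r3 : ∀ i j : Fin 3, W i.succ 0 0 j.succ * raise₄ (lapseMetric N g p)⁻¹ W i.succ 0 0 j.succ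
      = electric D N g p i j * ((g p)⁻¹ * electric D N g p * (g p)⁻¹) i j := fun i j => by
    simp only [raise₄, hF.inv_lapseMetric hp, sum_fin_four, blockMatrix_succ_zero,
      blockMatrix_succ_succ, blockMatrix_zero_zero, blockMatrix_zero_succ, zero_mul, mul_zero,
      Finset.sum_const_zero, zero_add, add_zero, w3, hq, Finset.mul_sum]
    refine Finset.sum_congr rfl fun k _ => Finset.sum_congr rfl fun l _ => ?_
    field_simp
  have r4 : ∀ i j : Fin 3, W i.succ 0 j.succ 0 * raise₄ (lapseMetric N g p)⁻¹ W i.succ 0 j.succ 0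
      = electric D N g p i j * ((g p)⁻¹ * electric D N g p * (g p)⁻¹) i j := fun i j => by
    simp only [raise₄, hF.inv_lapseMetric hp, sum_fin_four, blockMatrix_succ_zero,
      blockMatrix_succ_succ, blockMatrix_zero_zero, blockMatrix_zero_succ, zero_mul, mul_zero,
      Finset.sum_const_zero, zero_add, add_zero, w4, hq, Finset.mul_sum]
    refine Finset.sum_congr rfl fun k _ => Finset.sum_congr rfl fun l _ => ?_
    field_simp
  have z1 : ∀ a c d, W a a c d = 0 := fun a c d => by rw [← hWa, hF.weyl_same_left hp]
  have z2 : ∀ a b c, W a b c c = 0 := fun a b c => by rw [← hWa, weyl_same_right]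
  have m1 : ∀ i j k : Fin 3, W 0 i.succ j.succ k.succ = 0 := fun i j k => by rw [← hWa, hE p hp]
  have m2 : ∀ i j k : Fin 3, W i.succ 0 j.succ k.succ = 0 := fun i j k => by
    rw [hS.swap_left, m1, neg_zero]
  have m3 : ∀ i j k : Fin 3, W i.succ j.succ 0 k.succ = 0 := fun i j k => by
    rw [hS.pair_symm, m1]
  have m4 : ∀ i j k : Fin 3, W i.succ j.succ k.succ 0 = 0 := fun i j k => by
    rw [hS.swap_right, m3, neg_zero]
  have hV : ∀ i j k l : Fin 3, W i.succ j.succ k.succ l.succ = spatialWeyl D N g p i j k l :=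
    fun i j k l => by rw [← hWa]; rfl
  have ht : ∑ i, ∑ j, electric D N g p i j * ((g p)⁻¹ * electric D N g p * (g p)⁻¹) i j
      = ((g p)⁻¹ * electric D N g p * (g p)⁻¹ * electric D N g p).trace := by
    rw [Matrix.trace_mul_comm]
    exact sum_mul_eq_trace (isSymm_mul_mul (hF.symm p hp).inv (hF.isSymm_electric hp)) _
  have h5 := (hF.isCurvatureLike_spatialWeyl hp).sum_mul_raise₄ (hF.symm p hp) (hF.isUnit_det p hp)
    (hF.electric_eq_trace hp) (hF.trace_electric hp)
  rw [h1]
  -- Four placements of the time indices contribute 1 each and the spatial part contributes 4, in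
  -- total 8.
  simp only [sum_fin_four, z1, z2, m1, m2, m3, m4, r1, r2, r3, r4, zero_mul, Finset.sum_const_zero,
    zero_add, add_zero, h2, hV, Finset.sum_add_distrib, h5, ht]
  ring

end IsFoliated

end Coord4

/-! ### The evolution equation of E and the derivative of |W|². -/

namespace Coord4

namespace IsFoliated

variable {D : Set Coord4} {N : Coord4 → ℝ} {g : Coord4 → Matrix (Fin 3) (Fin 3) ℝ} {p : Coord4}
  (hF : IsFoliated D N g)
include hF

lemma pd_weyl_zero_succ_zero_succ (hp : p ∈ D) (i j : Fin 3) :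
    pd D 0 (weyl D (lapseMetric N g) 0 i.succ 0 j.succ) p
      = 2 * N p * pd D 0 N p * electric D N g p i j
        + N p ^ 2 * pdMat D 0 (electric D N g) p i j := by
  rw [pd_congr (fun q hq => hF.weyl_zero_succ_zero_succ hq i j) hp,
    pd_mul hF.uniqueDiffOn (hF.smooth_lapse.pow 2) (hF.smooth_electric i j) hp,
    hF.pd_lapse_sq hp]
  rfl

variable (hE : IsElectric D N g)
include hE

/-- The derivative of the factor N² in W_{0i0j} = N² E_{ij} cancels against the two terms with
Γ^0_{00}; the terms with Γ^m_{0i} and Γ^m_{0j} give h. -/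
lemma covDeriv₄_weyl_zero (hp : p ∈ D) (i j : Fin 3) :
    covDeriv₄ D (lapseMetric N g) (weyl D (lapseMetric N g)) 0 0 i.succ 0 j.succ p
      = N p ^ 2 * (pdMat D 0 (electric D N g) p
        + N p • (secondFundamentalForm D N g p * (g p)⁻¹ * electric D N g p
          + electric D N g p * (g p)⁻¹ * secondFundamentalForm D N g p)) i j := by
  have hN := hF.lapse_ne_zero p hp
  have h1 : (secondFundamentalForm D N g p * (g p)⁻¹ * electric D N g p) i j
      = ∑ m, ((g p)⁻¹ * secondFundamentalForm D N g p) m i * electric D N g p m j := by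
    rw [Matrix.mul_apply]
    refine Finset.sum_congr rfl fun m _ => ?_
    rw [← Matrix.transpose_apply ((g p)⁻¹ * _), Matrix.transpose_mul,
      (hF.isSymm_secondFundamentalForm hp).eq, (hF.symm p hp).inv.eq]
  have h2 : (electric D N g p * (g p)⁻¹ * secondFundamentalForm D N g p) i j
      = ∑ m, ((g p)⁻¹ * secondFundamentalForm D N g p) m j * electric D N g p i m := by
    rw [mul_assoc, Matrix.mul_apply]
    exact Finset.sum_congr rfl fun m _ => mul_comm _ _
  rw [covDeriv₄, sum_fin_four, hF.pd_weyl_zero_succ_zero_succ hp]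
  simp only [hF.christoffel_zero_zero_zero hp, hF.christoffel_succ_zero_succ hp,
    hF.weyl_zero_succ_zero_succ hp, hF.weyl_same_left hp, weyl_same_right,
    hF.weyl_succ_succ_zero_succ hE hp, hE p hp, mul_zero, add_zero, zero_add,
    Finset.sum_add_distrib, Matrix.add_apply, Matrix.smul_apply, smul_eq_mul, h1, h2]
  have h3 : ∀ v w : Fin 3 → ℝ, ∑ m, -(N p * v m) * (N p ^ 2 * w m) = -N p ^ 3 * ∑ m, v m * w m := by
    intro v w
    rw [Finset.mul_sum]
    exact Finset.sum_congr rfl fun m _ => by ring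
  rw [h3, h3]
  field_simp
  ring

/-- The differentiated component is identically zero, so only connection terms remain: Γ^0_{lk} and
Γ^0_{li} lead to E, and Γ^m_{l0} leads to the spatial Weyl tensor. -/
lemma covDeriv₄_weyl_succ (hp : p ∈ D) (k l i j : Fin 3) :
    covDeriv₄ D (lapseMetric N g) (weyl D (lapseMetric N g)) l.succ k.succ i.succ 0 j.succ p
      = N p * (secondFundamentalForm D N g p l k * electric D N g p i j
        - secondFundamentalForm D N g p l i * electric D N g p k j
        + ∑ m, ((g p)⁻¹ * secondFundamentalForm D N g p) m l * spatialWeyl D N g p k i m j) := by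
  have hN := hF.lapse_ne_zero p hp
  have h1 : pd D l.succ (weyl D (lapseMetric N g) k.succ i.succ 0 j.succ) p = 0 := by
    rw [pd_congr (fun q hq => hF.weyl_succ_succ_zero_succ hE hq k i j) hp]
    exact pd_const _ _
  have h2 : weyl D (lapseMetric N g) k.succ 0 0 j.succ p = -(N p ^ 2 * electric D N g p k j) := by
    rw [hF.isMetric.weyl_swap_left hp, hF.weyl_zero_succ_zero_succ hp]
  rw [covDeriv₄, sum_fin_four, h1]
  simp only [hF.christoffel_zero_succ_succ hp, hF.christoffel_succ_succ_zero hp, h2,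
    hF.weyl_zero_succ_zero_succ hp, weyl_same_right,
    hF.weyl_succ_succ_zero_succ hE hp, mul_zero, add_zero, zero_add]
  have h3 : ∑ m : Fin 3, -(N p * ((g p)⁻¹ * secondFundamentalForm D N g p) m l)
        * weyl D (lapseMetric N g) k.succ i.succ m.succ j.succ p
      = -N p * ∑ m, ((g p)⁻¹ * secondFundamentalForm D N g p) m l
        * spatialWeyl D N g p k i m j := by
    rw [Finset.mul_sum]
    exact Finset.sum_congr rfl fun m _ => by rw [spatialWeyl]; ring
  rw [h3]
  field_simp
  ring

/-- The time direction contributes -∂_t E - N(hqE + Eqh), the spatial directions N(HE - hqE), and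
the contraction of qhq with the Kulkarni-Nomizu product N(HE + tr(qhqE) g - Eqh - hqE). -/
lemma div₄_weyl_eq (hp : p ∈ D) (i j : Fin 3) :
    div₄ D (lapseMetric N g) (weyl D (lapseMetric N g)) i.succ 0 j.succ p
      = (-(pdMat D 0 (electric D N g) p)
        + N p • ((2 * ((g p)⁻¹ * secondFundamentalForm D N g p).trace) • electric D N g p
          + ((g p)⁻¹ * secondFundamentalForm D N g p * (g p)⁻¹ * electric D N g p).trace • g p
          - (3 : ℝ) • (secondFundamentalForm D N g p * (g p)⁻¹ * electric D N g p)
          - (2 : ℝ) • (electric D N g p * (g p)⁻¹ * secondFundamentalForm D N g p))) i j := by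
  have hN := hF.lapse_ne_zero p hp
  obtain ⟨q, hq⟩ : ∃ q, q = (g p)⁻¹ := ⟨_, rfl⟩
  obtain ⟨h, hh⟩ : ∃ h, h = secondFundamentalForm D N g p := ⟨_, rfl⟩
  have hqs : q.IsSymm := hq ▸ (hF.symm p hp).inv
  have hhs : h.IsSymm := hh ▸ hF.isSymm_secondFundamentalForm hp
  have hqg : q * g p = 1 := hq ▸ Matrix.nonsing_inv_mul _ (hF.isUnit_det p hp)
  have hgq : g p * q = 1 := hq ▸ Matrix.mul_nonsing_inv _ (hF.isUnit_det p hp)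
  have h0 : (-N p ^ 2)⁻¹ * (N p ^ 2) = -1 := by field_simp
  rw [div₄, hF.inv_lapseMetric hp]
  simp only [sum_fin_four, blockMatrix_zero_zero, blockMatrix_zero_succ, blockMatrix_succ_zero,
    blockMatrix_succ_succ, zero_mul, Finset.sum_const_zero, zero_add, add_zero,
    hF.covDeriv₄_weyl_zero hE hp, hF.covDeriv₄_weyl_succ hE hp]
  rw [← mul_assoc, h0, ← hq, ← hh]
  have hs : ∀ e : Fin 3 → Fin 3 → ℝ, ∑ k, ∑ l, q k l * (N p * e k l)
      = N p * ∑ k, ∑ l, q k l * e k l := fun e => by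
    simp only [Finset.mul_sum]
    exact Finset.sum_congr rfl fun k _ => Finset.sum_congr rfl fun l _ => by ring
  have h1 : ∑ k, ∑ l, q k l * (h l k * electric D N g p i j)
      = (q * h).trace * electric D N g p i j := by
    simp only [← sum_mul_eq_trace hhs, Finset.sum_mul, hhs.apply]
    exact Finset.sum_congr rfl fun k _ => Finset.sum_congr rfl fun l _ => by
      rw [hhs.apply]; ring
  have h2 : ∑ k, ∑ l, q k l * (h l i * electric D N g p k j) = (h * q * electric D N g p) i j := by
    simp only [Matrix.mul_apply, Finset.sum_mul]
    exact Finset.sum_congr rfl fun k _ => Finset.sum_congr rfl fun l _ => by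
      rw [hhs.apply l i, hqs.apply l k]; ring
  have h3 : ∑ k, ∑ l, q k l * ∑ m, (q * h) m l * spatialWeyl D N g p k i m j
      = ∑ k, ∑ m, (q * h * q) k m * spatialWeyl D N g p k i m j := by
    refine Finset.sum_congr rfl fun k _ => ?_
    simp only [Finset.mul_sum]
    rw [Finset.sum_comm]
    refine Finset.sum_congr rfl fun m _ => ?_
    rw [(isSymm_mul_mul hqs hhs).apply m k, Matrix.mul_apply, Finset.sum_mul]
    exact Finset.sum_congr rfl fun l _ => by rw [hqs.apply k l]; ring
  rw [hs]
  simp only [mul_add, mul_sub, Finset.sum_add_distrib, Finset.sum_sub_distrib, h1, h2, h3]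
  rw [hF.spatialWeyl_eq hp, sum_mul_kulkarniNomizu (hF.symm p hp) (hF.isSymm_electric hp)
    (isSymm_mul_mul hqs hhs)]
  have h4 : electric D N g p * (q * h * q) * g p = electric D N g p * q * h := by
    simp only [mul_assoc, hqg, mul_one]
  have h5 : g p * (q * h * q) * electric D N g p = h * q * electric D N g p := by
    simp only [← mul_assoc, hgq, one_mul]
  have h6 : (q * h * q * g p).trace = (q * h).trace := by
    rw [mul_assoc, hqg, mul_one]
  rw [h4, h5, h6]
  simp only [Matrix.add_apply, Matrix.sub_apply, Matrix.smul_apply, Matrix.neg_apply, smul_eq_mul]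
  ring

/-- The evolution equation of the electric part of a purely electric Weyl tensor. -/
lemma pdMat_electric (hp : p ∈ D) : pdMat D 0 (electric D N g) p
    = N p • ((2 * ((g p)⁻¹ * secondFundamentalForm D N g p).trace) • electric D N g p
          + ((g p)⁻¹ * secondFundamentalForm D N g p * (g p)⁻¹ * electric D N g p).trace • g p
          - (3 : ℝ) • (secondFundamentalForm D N g p * (g p)⁻¹ * electric D N g p)
          - (2 : ℝ) • (electric D N g p * (g p)⁻¹ * secondFundamentalForm D N g p)
          - (1 / 2 : ℝ) • normalCotton D N g p) := by
  have hN := hF.lapse_ne_zero p hp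
  ext i j
  have h1 := hF.div₄_weyl_eq hE hp i j
  have h2 : cotton D (lapseMetric N g) i.succ j.succ 0 p = N p * normalCotton D N g p i j := by
    simp only [normalCotton, Matrix.of_apply]
    field_simp
  rw [hF.isMetric.div₄_weyl hp, h2] at h1
  simp only [Matrix.add_apply, Matrix.sub_apply, Matrix.smul_apply, Matrix.neg_apply,
    smul_eq_mul] at h1 ⊢
  linarith

/-- The normal derivative of `|W|²` for a purely electric Weyl tensor, in terms of traces. -/
theorem normalDeriv_weylNormSq (hp : p ∈ D) :
    (1 / 2) * ((N p)⁻¹ * pd D 0 (weylNormSq D (lapseMetric N g)) p)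
      = 16 * ((g p)⁻¹ * secondFundamentalForm D N g p).trace
          * ((g p)⁻¹ * electric D N g p * (g p)⁻¹ * electric D N g p).trace
        - 24 * ((g p)⁻¹ * secondFundamentalForm D N g p * (g p)⁻¹ * electric D N g p * (g p)⁻¹
          * electric D N g p).trace
        - 4 * ((g p)⁻¹ * normalCotton D N g p * (g p)⁻¹ * electric D N g p).trace := by
  have hN := hF.lapse_ne_zero p hp
  have hU := hF.uniqueDiffOn
  have hq := hF.smooth.inv hF.isUnit_det
  have hEl := hF.smooth_electric
  have h1 : pd D 0 (weylNormSq D (lapseMetric N g)) p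
      = 8 * (pdMat D 0 (fun q => (g q)⁻¹ * electric D N g q * (g q)⁻¹ * electric D N g q) p).trace := by
    rw [pd_congr (fun q hq => hF.weylNormSq_eq hE hq) hp,
      ← pd_trace hU (((hq.mul hEl).mul hq).mul hEl) hp, pd_const_mul hU]
    · simp only [Matrix.trace, Matrix.diag]
      exact ContDiffOn.sum fun i _ => (((hq.mul hEl).mul hq).mul hEl) i i
    · exact hp
  have h2 : pdMat D 0 (fun q => (g q)⁻¹) p
      = (2 * N p) • ((g p)⁻¹ * secondFundamentalForm D N g p * (g p)⁻¹) := by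
    rw [pdMat_inv hU hF.smooth hF.isUnit_det hp, hF.pdMat_zero_metric hp]
    simp
  rw [h1, pdMat_mul hU ((hq.mul hEl).mul hq) hEl hp, pdMat_mul hU (hq.mul hEl) hq hp,
    pdMat_mul hU hq hEl hp, h2, hF.pdMat_electric hE hp]
  have hqg : (g p)⁻¹ * g p = 1 := Matrix.nonsing_inv_mul _ (hF.isUnit_det p hp)
  have htr : ((g p)⁻¹ * electric D N g p).trace = 0 := by
    rw [← sum_mul_eq_trace (hF.isSymm_electric hp), hF.trace_electric hp]
  generalize (g p)⁻¹ = q at *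
  generalize secondFundamentalForm D N g p = h at *
  generalize electric D N g p = E at *
  generalize normalCotton D N g p = C at *
  generalize g p = γ at *
  -- Cyclicity of the trace brings all words with two E's and one h to one form, and likewise those
  -- with C; the words with g reduce to tr(qE) = 0.
  have c1 : (q * (E * (q * (h * (q * E))))).trace = (q * (h * (q * (E * (q * E))))).trace := by
    rw [← mul_assoc q E, Matrix.trace_mul_comm]
    simp only [mul_assoc]
  have c2 : (q * (E * (q * (E * (q * h))))).trace = (q * (h * (q * (E * (q * E))))).trace := by
    rw [← mul_assoc q E, Matrix.trace_mul_comm, ← mul_assoc q E, mul_assoc, Matrix.trace_mul_comm]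
    simp only [mul_assoc]
  have c3 : (q * (E * (q * C))).trace = (q * (C * (q * E))).trace := by
    rw [← mul_assoc q E, Matrix.trace_mul_comm]
    simp only [mul_assoc]
  have c4 : (q * (γ * (q * E))).trace = 0 := by rw [← mul_assoc, hqg, one_mul, htr]
  have c5 : (q * (E * (q * γ))).trace = 0 := by rw [hqg, mul_one, htr]
  simp only [smul_add, smul_sub, smul_smul, Matrix.smul_mul, Matrix.mul_smul, Matrix.add_mul,
    Matrix.mul_add, Matrix.sub_mul, Matrix.mul_sub, Matrix.trace_add, Matrix.trace_sub,
    Matrix.trace_smul, smul_eq_mul, Matrix.mul_assoc, c1, c2, c3, c4, c5]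
  field_simp
  ring

end IsFoliated

end Coord4

/-! ### Passage from the spacetime to its coordinate expression in a chart. -/

lemma clm_sum_smul_sum_smul {ι F : Type*} [Fintype ι] [AddCommGroup F] [Module ℝ F]
    [TopologicalSpace F] (B : F →L[ℝ] F →L[ℝ] ℝ) (v : ι → ℝ) (c : ι → F) :
    B (∑ i, v i • c i) (∑ j, v j • c j) = ∑ i, ∑ j, v i * (B (c i) (c j) * v j) := by
  simp only [map_sum, map_smul, sum_apply, smul_apply, smul_eq_mul, Finset.mul_sum]
  rw [Finset.sum_comm]
  exact Finset.sum_congr rfl fun i _ => Finset.sum_congr rfl fun j _ => by ring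

namespace FoliatedSpacetime

variable {M : Type*} [TopologicalSpace M] [ChartedSpace (EuclideanSpace ℝ (Fin 3)) M]
  [IsManifold (𝓡 3) ∞ M] (X : FoliatedSpacetime M)
  {e : OpenPartialHomeomorph M (EuclideanSpace ℝ (Fin 3))}

lemma convex_interval : Convex ℝ X.interval := X.interval_ordConnected.convex

lemma interior_interval_nonempty : (interior X.interval).Nonempty := by
  obtain ⟨a, ha, b, hb, hab⟩ := X.interval_nontrivial.exists_lt
  have h : Set.Ioo a b ⊆ interior X.interval :=
    interior_maximal (Set.Ioo_subset_Icc_self.trans (X.interval_ordConnected.out ha hb)) isOpen_Ioo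
  exact (Set.nonempty_Ioo.2 hab).mono h

/-- A nondegenerate interval is convex with nonempty interior, so derivatives within the domain are
well determined even at an endpoint. -/
lemma uniqueDiffOn_domain : UniqueDiffOn ℝ (X.domain e) :=
  (uniqueDiffOn_convex X.convex_interval X.interior_interval_nonempty).prod
    e.open_target.uniqueDiffOn

lemma domain_subset_closure_interior : X.domain e ⊆ closure (interior (X.domain e)) := by
  rw [domain, interior_prod_eq, closure_prod_eq, e.open_target.interior_eq,
    X.convex_interval.closure_interior_eq_closure_of_nonempty_interior X.interior_interval_nonempty]
  exact Set.prod_mono subset_closure subset_closure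

variable (he : e ∈ IsManifold.maximalAtlas (𝓡 3) ∞ M)
include he

lemma contMDiffOn_chart_symm : ContMDiffOn 𝓘(ℝ, Coord4) (𝓡 3) ∞
    (fun q : Coord4 => e.symm q.2) (X.domain e) :=
  (contMDiffOn_symm_of_mem_maximalAtlas he).comp contDiff_snd.contMDiff.contMDiffOn
    fun _ hq => hq.2

lemma contMDiffOn_prod_chart_symm : ContMDiffOn 𝓘(ℝ, Coord4) (𝓘(ℝ, ℝ).prod (𝓡 3)) ∞
    (fun q : Coord4 => (q.1, e.symm q.2)) (X.domain e) :=
  contDiff_fst.contMDiff.contMDiffOn.prodMk (X.contMDiffOn_chart_symm he)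

omit he in
lemma mapsTo_prod_chart_symm : Set.MapsTo (fun q : Coord4 => (q.1, e.symm q.2)) (X.domain e)
    (X.interval ×ˢ Set.univ) := fun _ hq => ⟨hq.1, Set.mem_univ _⟩

lemma smooth_N : ContDiffOn ℝ ∞ (X.N e) (X.domain e) :=
  contMDiffOn_iff_contDiffOn.1
    (X.lapse_smooth.comp (X.contMDiffOn_prod_chart_symm he) X.mapsTo_prod_chart_symm)

/-- The coordinate field is the image of a constant section under the tangent map of the inverse
chart. -/
lemma contMDiffOn_coordVec (i : Fin 3) : ContMDiffOn 𝓘(ℝ, Coord4) (𝓡 3).tangent ∞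
    (fun q : Coord4 => (Bundle.TotalSpace.mk' (EuclideanSpace ℝ (Fin 3)) (e.symm q.2)
      (coordVec e i q.2) : TangentBundle (𝓡 3) M)) (X.domain e) := by
  have h1 := (contMDiffOn_symm_of_mem_maximalAtlas he).contMDiffOn_tangentMapWithin (m := ∞)
    (by simp) e.open_target.uniqueMDiffOn
  have h2 : ContMDiffOn 𝓘(ℝ, Coord4) (𝓡 3).tangent ∞ (fun q : Coord4 =>
      (⟨q.2, EuclideanSpace.single i (1 : ℝ)⟩ : TangentBundle (𝓡 3) (EuclideanSpace ℝ (Fin 3))))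
      (X.domain e) := by
    have h3 : ContMDiffOn (𝓡 3) (𝓡 3).tangent ∞ (fun y : EuclideanSpace ℝ (Fin 3) =>
      (⟨y, EuclideanSpace.single i (1 : ℝ)⟩ : TangentBundle (𝓡 3) (EuclideanSpace ℝ (Fin 3))))
      Set.univ := contMDiffOn_vectorSpace_iff_contDiffOn.2 contDiffOn_const
    exact h3.comp contDiff_snd.contMDiff.contMDiffOn fun _ _ => Set.mem_univ _
  refine (h1.comp h2 fun q hq => hq.2).congr fun q hq => ?_
  simp only [Function.comp, tangentMapWithin, coordVec]
  rw [mfderivWithin_of_mem_nhds (e.open_target.mem_nhds hq.2)]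

lemma smooth_g : Coord4.SmoothMat (X.domain e) (X.g e) := fun i j => by
  have hm := X.metric_smooth.comp (X.contMDiffOn_prod_chart_symm he) X.mapsTo_prod_chart_symm
  have h := ContMDiffOn.clm_bundle_apply₂ (F₁ := EuclideanSpace ℝ (Fin 3))
    (F₂ := EuclideanSpace ℝ (Fin 3)) (F₃ := ℝ) (E₃ := Bundle.Trivial M ℝ) hm
    (X.contMDiffOn_coordVec he i)
    (X.contMDiffOn_coordVec he j)
  exact contMDiffOn_iff_contDiffOn.1 fun q hq => (Bundle.contMDiffWithinAt_totalSpace.1 (h q hq)).2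

/-- The quadratic form of g_{ij} at v is the metric on the push-forward of v, which is nonzero
because the derivative of the inverse chart is injective. -/
lemma posDef_g {p : Coord4} (hp : p ∈ X.domain e) : (X.g e p).PosDef := by
  refine Matrix.PosDef.of_dotProduct_mulVec_pos ?_ fun v hv => ?_
  · ext i j
    exact X.metric_symm p.1 hp.1 _ _ _
  have hm : e.symm.MDifferentiable (𝓡 3) (𝓡 3) :=
    ⟨(contMDiffOn_symm_of_mem_maximalAtlas he).mdifferentiableOn (by simp),
      (contMDiffOn_of_mem_maximalAtlas he).mdifferentiableOn (by simp)⟩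
  have hinj := hm.mfderiv_injective (x := p.2) hp.2
  have hv' : WithLp.toLp 2 v = ∑ i, v i • EuclideanSpace.single i (1 : ℝ) := by
    ext j
    simp [Finset.sum_apply, Pi.single_apply]
  have hne : mfderiv (𝓡 3) (𝓡 3) e.symm p.2 (WithLp.toLp 2 v) ≠ 0 := by
    intro h0
    have h1 : (WithLp.toLp 2 v : EuclideanSpace ℝ (Fin 3)) = 0 := hinj (h0.trans (map_zero _).symm)
    exact hv (by simpa using h1)
  have hpos := X.metric_pos p.1 hp.1 (e.symm p.2) _ hne
  have hw : mfderiv (𝓡 3) (𝓡 3) e.symm p.2 (WithLp.toLp 2 v) = ∑ i, v i • coordVec e i p.2 := by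
    rw [hv']
    exact (map_sum _ _ _).trans (Finset.sum_congr rfl fun i _ => map_smul _ _ _)
  rw [hw, clm_sum_smul_sum_smul] at hpos
  simpa only [star_trivial, dotProduct, Matrix.mulVec, g, Matrix.of_apply, Finset.mul_sum, mul_assoc,
    mul_comm, mul_left_comm] using hpos

lemma isFoliated : Coord4.IsFoliated (X.domain e) (X.N e) (X.g e) where
  uniqueDiffOn := X.uniqueDiffOn_domain
  subset_closure := X.domain_subset_closure_interior
  smooth_lapse := X.smooth_N he
  lapse_ne_zero q hq := (X.lapse_pos q.1 hq.1 _).ne'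
  smooth := X.smooth_g he
  symm q hq := by
    ext i j
    exact X.metric_symm q.1 hq.1 _ _ _
  isUnit_det q hq := (X.posDef_g he hq).isUnit.map Matrix.detMonoidHom

end FoliatedSpacetime

theorem propositionA4 {M : Type*} [TopologicalSpace M]
    [ChartedSpace (EuclideanSpace ℝ (Fin 3)) M] [IsManifold (𝓡 3) ∞ M]
    (X : FoliatedSpacetime M) (hX : X.PureElectric)
    (e : OpenPartialHomeomorph M (EuclideanSpace ℝ (Fin 3)))
    (he : e ∈ IsManifold.maximalAtlas (𝓡 3) ∞ M)
    (p : Coord4) (hp : p ∈ X.domain e) :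
    (1 / 2) * X.normalDeriv e (X.weylNormSq e) p =
      16 * X.meanCurv e p * X.electricNormSq e p - 24 * X.hWW e p - 4 * X.CW e p := by
  have hF := X.isFoliated he
  -- The nonzero factor 1/N between T and ∂_t is dropped.
  have hE : Coord4.IsElectric (X.domain e) (X.N e) (X.g e) := fun q hq i j k =>
    (mul_eq_zero.1 (hX e he q hq i j k)).resolve_left (inv_ne_zero (hF.lapse_ne_zero q hq))
  have hq := (hF.symm p hp).inv
  have hW := hF.isSymm_electric hp
  have h1 : X.meanCurv e p
      = ((X.g e p)⁻¹ * Coord4.secondFundamentalForm (X.domain e) (X.N e) (X.g e) p).trace :=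
    (sum_mul_eq_trace (hF.isSymm_secondFundamentalForm hp) _ :)
  -- The index sums of the statement unfold to the sums in the trace lemmas; the traces on the right
  -- are read off from those.
  have h2 : X.electricNormSq e p = _ :=
    sum_contract_two hq hW (Coord4.electric (X.domain e) (X.N e) (X.g e) p)
  have h3 : X.CW e p = _ :=
    sum_contract_two hq hW (Coord4.normalCotton (X.domain e) (X.N e) (X.g e) p)
  have h4 : X.hWW e p = _ := sum_contract_three hq (hF.isSymm_secondFundamentalForm hp) hW
  rw [h1, h2, h3, h4]
  exact hF.normalDeriv_weylNormSq hE hp
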